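/- Let $n\ge 2$ and $a>0$. Let $\mathbb{H}^n$ be hyperbolic space in the ball model $\mathbb{B}=\{x\in\mathbb{R}^n : |x|<1\}$, with metric $\big(\tfrac{2}{1-|x|^2}\big)^2|dx|^2$, and equip $\mathbb{H}^n\times\mathbb{R}$ with the product of this metric and $dt^2$. Let $f : I\to(0,\infty)$, where $I\ni 0$ is an open interval, be the maximal solution of the Cauchy problem $$f'' = (n-1)\coth(f)\,\big(1+(f')^2\big),\qquad f(0)=a,\quad f'(0)=0 .$$ The $n$-dimensional catenoid $\mathcal{C}_a$ is the rotation hypersurface of $\mathbb{H}^n\times\mathbb{R}$ parametrized by $$X : I\times S^{n-1}\to \mathbb{H}^n\times\mathbb{R},\qquad X(t,\xi)=\big(\tanh(f(t)/2)\,\xi,\; t\big).$$ Let $d\mu_a$ be its Riemannian measure for the induced metric, let $A_a$ be its second fundamental form with respect to a unit normal, and let $|A_a|$ be the norm of $A_a$ for the induced metric. Then: 1. $\mathcal{C}_a$ has infinite volume, $\int_{\mathcal{C}_a} d\mu_a=\infty$. 2. $\mathcal{C}_a$ has finite total extrinsic curvature, $\int_{\mathcal{C}_a}|A_a|^n\,d\mu_a<\infty$.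 3. If $n=2$ and $K_a$ is the Gauss curvature of the induced metric, then $\mathcal{C}_a$ has infinite total intrinsic curvature, $\int_{\mathcal{C}_a}|K_a|\,d\mu_a=\infty$. -/

import Mathlib

open scoped ENNReal

noncomputable section

namespace Catenoid

/-! ### Riemannian geometry in coordinates

A metric on an open subset of a real normed space `W` is written `g : W → W → W → ℝ`, the value of
`g p u v` being the inner product at the point `p` of the tangent vectors `u` and `v`. -/

/-- Christoffel symbols of the first kind of the metric `g` at `p`. This is `g p (∇_u V) w`,
where `∇` is the Levi-Civita connection of `g` and `V` the vector field with constant value `v`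
(Koszul formula for constant, hence commuting, vector fields). -/
def christoffel {W : Type*} [NormedAddCommGroup W] [NormedSpace ℝ W]
    (g : W → W → W → ℝ) (p u v w : W) : ℝ :=
  (fderiv ℝ (fun q => g q v w) p u + fderiv ℝ (fun q => g q u w) p v
    - fderiv ℝ (fun q => g q u v) p w) / 2

/-- The `i`-th vector of the standard basis of `ℝⁿ`. -/
def stdVec {n : ℕ} (i : Fin n) : EuclideanSpace ℝ (Fin n) := EuclideanSpace.single i 1

/-- The matrix of a bilinear form on `ℝⁿ` in the standard basis. -/
def coordMatrix {n : ℕ} (b : EuclideanSpace ℝ (Fin n) → EuclideanSpace ℝ (Fin n) → ℝ) :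
    Matrix (Fin n) (Fin n) ℝ :=
  Matrix.of fun i j => b (stdVec i) (stdVec j)

/-- The Riemannian measure `√(det (g_ij)) dy` of a metric `g` on `U ⊆ ℝⁿ`. -/
def riemannianMeasure {n : ℕ}
    (g : EuclideanSpace ℝ (Fin n) → EuclideanSpace ℝ (Fin n) → EuclideanSpace ℝ (Fin n) → ℝ)
    (U : Set (EuclideanSpace ℝ (Fin n))) : MeasureTheory.Measure (EuclideanSpace ℝ (Fin n)) :=
  (MeasureTheory.volume.restrict U).withDensity
    fun y => ENNReal.ofReal (Real.sqrt (coordMatrix (g y)).det)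

/-- The inner product `∑ g^{ij} α_i β_j` at `y` of two covectors `α` and `β`. -/
def covectorInner {n : ℕ}
    (g : EuclideanSpace ℝ (Fin n) → EuclideanSpace ℝ (Fin n) → EuclideanSpace ℝ (Fin n) → ℝ)
    (y : EuclideanSpace ℝ (Fin n)) (α β : EuclideanSpace ℝ (Fin n) → ℝ) : ℝ :=
  ∑ i, ∑ j, (coordMatrix (g y))⁻¹ i j * α (stdVec i) * β (stdVec j)

/-- The Riemann curvature tensor `⟨R(u, v) w, z⟩` of a metric `g`, with
`R(u, v) = ∇_u ∇_v - ∇_v ∇_u` on constant vector fields. It uses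
`⟨∇_u ∇_v w, z⟩ = u ⟨∇_v w, z⟩ - ⟨∇_v w, ∇_u z⟩`. -/
def riemannTensor {n : ℕ}
    (g : EuclideanSpace ℝ (Fin n) → EuclideanSpace ℝ (Fin n) → EuclideanSpace ℝ (Fin n) → ℝ)
    (y u v w z : EuclideanSpace ℝ (Fin n)) : ℝ :=
  (fderiv ℝ (fun q => christoffel g q v w z) y u
      - covectorInner g y (christoffel g y v w) (christoffel g y u z))
    - (fderiv ℝ (fun q => christoffel g q u w z) y v
      - covectorInner g y (christoffel g y u w) (christoffel g y v z))

/-- The Gauss curvature `⟨R(e₀, e₁) e₁, e₀⟩ / det (g_ij)` of a metric in dimension two. -/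
def gaussCurvature
    (g : EuclideanSpace ℝ (Fin 2) → EuclideanSpace ℝ (Fin 2) → EuclideanSpace ℝ (Fin 2) → ℝ)
    (y : EuclideanSpace ℝ (Fin 2)) : ℝ :=
  riemannTensor g y (stdVec 0) (stdVec 1) (stdVec 1) (stdVec 0) / (coordMatrix (g y)).det

/-! ### Hypersurfaces of `ℍⁿ × ℝ`

`ℍⁿ × ℝ` is the open subset `{(x, t) : ‖x‖ < 1}` of `ℝⁿ × ℝ` (ball model of `ℍⁿ`), with the product
of the hyperbolic metric `(2 / (1 - ‖x‖²))² ‖dx‖²` and `dt²`. -/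

/-- The product metric of `ℍⁿ × ℝ`, in the ball model. -/
def ambientMetric (n : ℕ) (p u v : EuclideanSpace ℝ (Fin n) × ℝ) : ℝ :=
  (2 / (1 - ‖p.1‖ ^ 2)) ^ 2 * inner ℝ u.1 v.1 + u.2 * v.2

/-- The metric induced on the parameter domain by a parametrization `X` of a hypersurface. -/
def inducedMetric {n : ℕ} (X : EuclideanSpace ℝ (Fin n) → EuclideanSpace ℝ (Fin n) × ℝ)
    (y u v : EuclideanSpace ℝ (Fin n)) : ℝ :=
  ambientMetric n (X y) (fderiv ℝ X y u) (fderiv ℝ X y v)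

/-- `N` is a field of unit normals along the hypersurface parametrized by `X` on `U`. -/
def IsUnitNormal {n : ℕ} (X : EuclideanSpace ℝ (Fin n) → EuclideanSpace ℝ (Fin n) × ℝ)
    (U : Set (EuclideanSpace ℝ (Fin n)))
    (N : EuclideanSpace ℝ (Fin n) → EuclideanSpace ℝ (Fin n) × ℝ) : Prop :=
  ∀ y ∈ U, ambientMetric n (X y) (N y) (N y) = 1 ∧
    ∀ u, ambientMetric n (X y) (fderiv ℝ X y u) (N y) = 0

/-- The second fundamental form with respect to `N`: the `N`-component of the ambient covariant
derivative along `u` of the tangent field `dX(v)`. -/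
def secondForm {n : ℕ} (X N : EuclideanSpace ℝ (Fin n) → EuclideanSpace ℝ (Fin n) × ℝ)
    (y u v : EuclideanSpace ℝ (Fin n)) : ℝ :=
  ambientMetric n (X y) (fderiv ℝ (fun q => fderiv ℝ X q v) y u) (N y)
    + christoffel (ambientMetric n) (X y) (fderiv ℝ X y u) (fderiv ℝ X y v) (N y)

/-- The norm of the second fundamental form for the induced metric,
`|A|² = g^{ij} A_{jk} g^{kl} A_{li}`. -/
def secondFormNorm {n : ℕ} (X N : EuclideanSpace ℝ (Fin n) → EuclideanSpace ℝ (Fin n) × ℝ)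
    (y : EuclideanSpace ℝ (Fin n)) : ℝ :=
  Real.sqrt (((coordMatrix (inducedMetric X y))⁻¹ * coordMatrix (secondForm X N y)) ^ 2).trace

/-! ### Catenoids -/

/-- `f` solves on the open interval `I ∋ 0` the Cauchy problem
`f'' = (n - 1) coth(f) (1 + f'²)`, `f(0) = a`, `f'(0) = 0`, with positive values. -/
structure IsSolution (n : ℕ) (a : ℝ) (I : Set ℝ) (f : ℝ → ℝ) : Prop where
  isOpen : IsOpen I
  ordConnected : I.OrdConnected
  zero_mem : (0 : ℝ) ∈ I
  pos : ∀ t ∈ I, 0 < f t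
  differentiableAt : ∀ t ∈ I, DifferentiableAt ℝ f t
  ode : ∀ t ∈ I, HasDerivAt (deriv f)
    (((n : ℝ) - 1) * (Real.cosh (f t) / Real.sinh (f t)) * (1 + deriv f t ^ 2)) t
  value_zero : f 0 = a
  deriv_zero : deriv f 0 = 0

/-- `(I, f)` is a maximal solution: it has no solution extending it to a larger open interval. -/
structure IsMaximalSolution (n : ℕ) (a : ℝ) (I : Set ℝ) (f : ℝ → ℝ) : Prop
    extends IsSolution n a I f where
  maximal : ∀ (J : Set ℝ) (h : ℝ → ℝ), IsSolution n a J h → I ⊆ J → Set.EqOn h f I → J ⊆ I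

/-- The rotation hypersurface `(t, ξ) ↦ (tanh(f(t)/2) ξ, t)` with generating curve
`t ↦ (tanh(f(t)/2), t)`, for `ξ` in the unit sphere. -/
def rotationMap {n : ℕ} (f : ℝ → ℝ) (p : ℝ × EuclideanSpace ℝ (Fin n)) :
    EuclideanSpace ℝ (Fin n) × ℝ :=
  (Real.tanh (f p.1 / 2) • p.2, p.1)

/-- The parameter domain `{eᵗ ξ : t ∈ I, ξ ∈ Sⁿ⁻¹}`, an open annulus of `ℝⁿ`. -/
def annulus (n : ℕ) (I : Set ℝ) : Set (EuclideanSpace ℝ (Fin n)) :=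
  {y | y ≠ 0 ∧ Real.log ‖y‖ ∈ I}

/-- The rotation hypersurface, read in the global chart of `I × Sⁿ⁻¹` given by the diffeomorphism
`(t, ξ) ↦ eᵗ ξ` onto the annulus, whose inverse is `y ↦ (log ‖y‖, y / ‖y‖)`. -/
def rotationChart (n : ℕ) (f : ℝ → ℝ) (y : EuclideanSpace ℝ (Fin n)) :
    EuclideanSpace ℝ (Fin n) × ℝ :=
  rotationMap f (Real.log ‖y‖, ‖y‖⁻¹ • y)

/-- The Riemannian measure of the hypersurface with generating function `f` over `I`. -/
def rotationMeasure (n : ℕ) (I : Set ℝ) (f : ℝ → ℝ) :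
    MeasureTheory.Measure (EuclideanSpace ℝ (Fin n)) :=
  riemannianMeasure (inducedMetric (rotationChart n f)) (annulus n I)

end Catenoid

end

noncomputable section

namespace Catenoid

open Set Filter Topology MeasureTheory

/-! Everything rests on the first integral `w := √(1 + f'²) = (sinh f / sinh a) ^ (n - 1)`
(`one_add_deriv_sq`). It gives `f ≥ a`, and it bounds `f'` wherever `f` is bounded. Since `f'' ≥ 1 +
f'²`, the function `arctan f' - t` is monotone, so `I` has finite length (`subset_Icc`). Were `f`
bounded, `f` and `f'` would have limits at the right end of `I` and the solution could be restarted
there; maximality thus makes `f` unbounded (`not_bddAbove`).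

In the coordinates `(t, ξ)` the volume density is `w sinh^(n-1) f`. It is at least `|f'| sinh^(n-1)
a`, whose integral diverges because `f` is unbounded: the volume is infinite.

Up to sign, the principal curvatures are `coth f / w`, taken `n - 1` times, and `(n - 1) coth f /
w`, so `|A| = √(n(n-1)) coth f / w`. By the first integral the density is `w² sinh^(n-1) a`, so the
integrand of `∫ |A|ⁿ` is at most a constant times `w^(2-n) ≤ 1`, on an interval of finite length.
This part holds for every solution, maximal or not.

For `n = 2`, `K = -(coth² f + f'²) / (1 + f'²)`; since `coth f ≥ 1`, `|K| ≥ 1` and the total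
intrinsic curvature dominates the infinite area. -/

theorem hasDerivAt_ite_lt {u v u' : ℝ → ℝ} {T e : ℝ}
    (hu : ∀ᶠ t in 𝓝[<] T, HasDerivAt u (u' t) t) (hlim : Tendsto u (𝓝[<] T) (𝓝 (v T)))
    (hlim' : Tendsto u' (𝓝[<] T) (𝓝 e)) (hv : HasDerivAt v e T) :
    HasDerivAt (fun t => if t < T then u t else v t) e T := by
  set w : ℝ → ℝ := fun t => if t < T then u t else v t with hw
  have hwT : w T = v T := by simp [hw]
  have hr : HasDerivWithinAt w e (Ici T) T :=
    hv.hasDerivWithinAt.congr (fun x hx => by simp [hw, not_lt.2 (mem_Ici.1 hx)]) hwT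
  obtain ⟨b, hb, hbs⟩ := mem_nhdsLT_iff_exists_Ioo_subset.1 hu
  have hd : ∀ t ∈ Ioo b T, HasDerivAt w (u' t) t := by
    intro t ht
    refine (hbs ht : HasDerivAt u (u' t) t).congr_of_eventuallyEq ?_
    filter_upwards [Iio_mem_nhds ht.2] with s hs
    simp [hw, mem_Iio.1 hs]
  -- A left-continuous function whose derivative has a limit from the left is left-differentiable
  -- with that limit as derivative.
  have hl : HasDerivWithinAt w e (Iic T) T := by
    refine hasDerivWithinAt_Iic_of_tendsto_deriv (s := Ioo b T)
      (fun t ht => (hd t ht).differentiableAt.differentiableWithinAt) ?_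
      (Ioo_mem_nhdsLT hb) ?_
    · rw [ContinuousWithinAt, hwT]
      refine (hlim.congr' ?_).mono_left (nhdsWithin_mono _ (fun t ht => ht.2))
      filter_upwards [self_mem_nhdsWithin] with s hs
      simp [hw, mem_Iio.1 hs]
    · refine hlim'.congr' ?_
      filter_upwards [Ioo_mem_nhdsLT hb] with s hs
      exact (hd s hs).deriv.symm
  simpa using hl.union hr

/-! ### First integral and a priori bounds for the catenary -/

namespace IsSolution

variable {n : ℕ} {a : ℝ} {I : Set ℝ} {f : ℝ → ℝ}

theorem hasDerivAt (h : IsSolution n a I f) {t : ℝ} (ht : t ∈ I) : HasDerivAt f (deriv f t) t :=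
  (h.differentiableAt t ht).hasDerivAt

theorem sinh_pos (h : IsSolution n a I f) {t : ℝ} (ht : t ∈ I) : 0 < Real.sinh (f t) :=
  Real.sinh_pos_iff.2 (h.pos t ht)

theorem initial_pos (h : IsSolution n a I f) : 0 < a := h.value_zero ▸ h.pos 0 h.zero_mem

theorem sinh_initial_pos (h : IsSolution n a I f) : 0 < Real.sinh a :=
  Real.sinh_pos_iff.2 h.initial_pos

theorem continuousOn (h : IsSolution n a I f) : ContinuousOn f I := fun _ ht =>
  (h.differentiableAt _ ht).continuousAt.continuousWithinAt

theorem continuousOn_deriv (h : IsSolution n a I f) : ContinuousOn (deriv f) I := fun _ ht =>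
  (h.ode _ ht).continuousAt.continuousWithinAt

theorem convex (h : IsSolution n a I f) : Convex ℝ I := h.ordConnected.convex

/-- The first integral of the catenary equation. -/
theorem one_add_deriv_sq (hn : 2 ≤ n) (h : IsSolution n a I f) {t : ℝ} (ht : t ∈ I) :
    1 + deriv f t ^ 2 = ((Real.sinh (f t) / Real.sinh a) ^ (n - 1)) ^ 2 := by
  obtain ⟨k, rfl⟩ : ∃ k, n = k + 2 := ⟨n - 2, by omega⟩
  -- Dividing the equation by `1 + f'²` and multiplying by `2 f'` makes both sides logarithmic
  -- derivatives; `E` is the resulting conserved quantity.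
  set E : ℝ → ℝ := fun t => (1 + deriv f t ^ 2) / (Real.sinh (f t) ^ (k + 1)) ^ 2 with hE
  have hd : ∀ t ∈ I, HasDerivAt E 0 t := by
    intro t ht
    have hs := (h.sinh_pos ht).ne'
    have h1 : HasDerivAt (fun t => 1 + deriv f t ^ 2) _ t := ((h.ode t ht).pow 2).const_add 1
    have h2 : HasDerivAt (fun t => (Real.sinh (f t) ^ (k + 1)) ^ 2) _ t :=
      (((h.hasDerivAt ht).sinh).pow (k + 1)).pow 2
    refine (h1.div h2 (by positivity)).congr_deriv ?_
    simp only [div_eq_zero_iff]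
    left
    push_cast
    simp only [Pi.pow_apply, pow_succ]
    field_simp
    ring
  have hc : E t = E 0 := by
    refine h.isOpen.is_const_of_deriv_eq_zero h.convex.isPreconnected
      (fun t ht => (hd t ht).differentiableAt.differentiableWithinAt)
      (fun t ht => (hd t ht).deriv) ht h.zero_mem
  simp only [hE, h.value_zero, h.deriv_zero] at hc
  have hs := (h.sinh_pos ht).ne'
  have ha := h.sinh_initial_pos.ne'
  rw [div_eq_div_iff (by positivity) (by positivity)] at hc
  simp only [show k + 2 - 1 = k + 1 by omega]
  rw [div_pow, div_pow, eq_div_iff (by positivity), hc]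
  ring

theorem sqrt_one_add_deriv_sq (hn : 2 ≤ n) (h : IsSolution n a I f) {t : ℝ} (ht : t ∈ I) :
    √(1 + deriv f t ^ 2) = (Real.sinh (f t) / Real.sinh a) ^ (n - 1) := by
  have := h.sinh_pos ht
  have := h.sinh_initial_pos
  rw [h.one_add_deriv_sq hn ht, Real.sqrt_sq (by positivity)]

/-- Where `f < a`, the first integral would force `√(1 + f'²) < 1`. -/
theorem initial_le (hn : 2 ≤ n) (h : IsSolution n a I f) {t : ℝ} (ht : t ∈ I) : a ≤ f t := by
  have h1 := h.sinh_pos ht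
  have h2 := h.sinh_initial_pos
  by_contra! hlt
  have h3 : Real.sinh (f t) / Real.sinh a < 1 := by
    rw [div_lt_one h2]; exact Real.sinh_lt_sinh.2 hlt
  have h4 : (Real.sinh (f t) / Real.sinh a) ^ (n - 1) < 1 :=
    pow_lt_one₀ (by positivity) h3 (by omega)
  have h5 : √(1 + deriv f t ^ 2) ≥ 1 := Real.one_le_sqrt.2 (by nlinarith [sq_nonneg (deriv f t)])
  rw [h.sqrt_one_add_deriv_sq hn ht] at h5
  linarith

theorem one_le_coth (h : IsSolution n a I f) {t : ℝ} (ht : t ∈ I) :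
    1 ≤ Real.cosh (f t) / Real.sinh (f t) := by
  rw [one_le_div (h.sinh_pos ht)]
  exact (Real.sinh_lt_cosh _).le

theorem second_deriv_ge (hn : 2 ≤ n) (h : IsSolution n a I f) {t : ℝ} (ht : t ∈ I) :
    1 + deriv f t ^ 2 ≤
      ((n : ℝ) - 1) * (Real.cosh (f t) / Real.sinh (f t)) * (1 + deriv f t ^ 2) := by
  have h1 : (1 : ℝ) ≤ (n : ℝ) - 1 := by
    have : (2 : ℝ) ≤ n := by exact_mod_cast hn
    linarith
  have h2 := one_le_coth h ht
  have h3 : 1 ≤ ((n : ℝ) - 1) * (Real.cosh (f t) / Real.sinh (f t)) := by nlinarith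
  nlinarith [sq_nonneg (deriv f t)]

theorem deriv_monotoneOn (hn : 2 ≤ n) (h : IsSolution n a I f) : MonotoneOn (deriv f) I := by
  refine monotoneOn_of_deriv_nonneg h.convex h.continuousOn_deriv ?_ ?_ <;>
    rw [h.isOpen.interior_eq]
  · exact fun t ht => (h.ode t ht).differentiableAt.differentiableWithinAt
  · intro t ht
    rw [(h.ode t ht).deriv]
    nlinarith [h.second_deriv_ge hn ht, sq_nonneg (deriv f t)]

theorem monotoneOn (hn : 2 ≤ n) (h : IsSolution n a I f) : MonotoneOn f (I ∩ Ici 0) := by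
  refine monotoneOn_of_deriv_nonneg (h.convex.inter (convex_Ici 0))
    (h.continuousOn.mono inter_subset_left) ?_ ?_
  · exact fun t ht => (h.differentiableAt t (interior_subset ht).1).differentiableWithinAt
  · intro t ht
    have := interior_subset ht
    rw [← h.deriv_zero]
    exact h.deriv_monotoneOn hn h.zero_mem this.1 this.2

/-- The angle `arctan f'` increases at speed at least 1, vanishes at 0 and stays in `(-π/2, π/2)`,
so there is room only for `|t| ≤ π/2`. -/
theorem subset_Icc (hn : 2 ≤ n) (h : IsSolution n a I f) :
    I ⊆ Icc (-(Real.pi / 2)) (Real.pi / 2) := by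
  have hm : MonotoneOn (fun t => Real.arctan (deriv f t) - t) I := by
    have hd : ∀ t ∈ I, HasDerivAt (fun t => Real.arctan (deriv f t) - t) _ t := fun t ht =>
      ((h.ode t ht).arctan).sub (hasDerivAt_id t)
    refine monotoneOn_of_deriv_nonneg h.convex
      (fun t ht => (hd t ht).continuousAt.continuousWithinAt) ?_ ?_ <;>
      rw [h.isOpen.interior_eq]
    · exact fun t ht => (hd t ht).differentiableAt.differentiableWithinAt
    · intro t ht
      rw [(hd t ht).deriv, sub_nonneg, one_div_mul_eq_div, one_le_div (by positivity)]
      exact h.second_deriv_ge hn ht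
  intro t ht
  have hz : Real.arctan (deriv f 0) - 0 = 0 := by simp [h.deriv_zero]
  have h1 := Real.arctan_lt_pi_div_two (deriv f t)
  have h2 := Real.neg_pi_div_two_lt_arctan (deriv f t)
  rcases le_total 0 t with h0 | h0
  · have := hm h.zero_mem ht h0
    simp only [hz] at this
    constructor <;> linarith [Real.pi_pos]
  · have := hm ht h.zero_mem h0
    simp only [hz] at this
    constructor <;> linarith [Real.pi_pos]

end IsSolution

/-! ### Local existence and blow-up of the maximal solution -/

/-- The catenary equation as a first order system. -/
theorem exists_local_solution (c L M T : ℝ) (hL : 0 < L) :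
    ∃ x p : ℝ → ℝ, x T = L ∧ p T = M ∧ ∃ ε > 0, ∀ t ∈ Ioo (T - ε) (T + ε),
      0 < x t ∧ HasDerivAt x (p t) t ∧
      HasDerivAt p (c * (Real.cosh (x t) / Real.sinh (x t)) * (1 + p t ^ 2)) t := by
  have hsm : ContDiffAt ℝ 1
      (fun q : ℝ × ℝ => ((q.2, c * (Real.cosh q.1 / Real.sinh q.1) * (1 + q.2 ^ 2)) : ℝ × ℝ))
      (L, M) := by
    have hs : Real.sinh (L, M).1 ≠ 0 := (Real.sinh_pos_iff.2 hL).ne'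
    have h1 : ContDiffAt ℝ 1 (fun q : ℝ × ℝ => Real.cosh q.1 / Real.sinh q.1) (L, M) :=
      (Real.contDiff_cosh.comp contDiff_fst).contDiffAt.div
        (Real.contDiff_sinh.comp contDiff_fst).contDiffAt hs
    exact contDiffAt_snd.prodMk ((contDiffAt_const.mul h1).mul
      (contDiffAt_const.add (contDiffAt_snd.pow 2)))
  obtain ⟨α, hα, ε, hε, hd⟩ :=
    hsm.exists_forall_mem_closedBall_exists_eq_forall_mem_Ioo_hasDerivAt₀ T
  have hT : T ∈ Ioo (T - ε) (T + ε) := ⟨by linarith, by linarith⟩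
  have hcont : ContinuousAt (fun t => (α t).1) T := (hd T hT).continuousAt.fst
  -- Positivity is part of being a solution; it survives near `T` by continuity, at the cost of
  -- shrinking the interval.
  have hpos : ∀ᶠ t in 𝓝 T, 0 < (α t).1 := hcont.eventually (lt_mem_nhds (by simpa [hα] using hL))
  obtain ⟨δ, hδ, hball⟩ := Metric.eventually_nhds_iff.1 hpos
  refine ⟨fun t => (α t).1, fun t => (α t).2, by simp [hα], by simp [hα], min ε δ,
    lt_min hε hδ, fun t ht => ?_⟩
  have ht' : t ∈ Ioo (T - ε) (T + ε) :=
    ⟨by linarith [ht.1, min_le_left ε δ], by linarith [ht.2, min_le_left ε δ]⟩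
  refine ⟨hball ?_, (hd t ht').fst, (hd t ht').snd⟩
  rw [Real.dist_eq, abs_lt]
  constructor <;> linarith [ht.1, ht.2, min_le_right ε δ]

/-- Continuation argument: on a bounded solution `f` and `f'` are monotone and bounded up to `T =
sup I`, so they converge, and a local solution started from the limits `(L, M)` at `T` glues to a
solution past `T`. -/
theorem IsMaximalSolution.not_bddAbove {n : ℕ} {a : ℝ} {I : Set ℝ} {f : ℝ → ℝ} (hn : 2 ≤ n)
    (h : IsMaximalSolution n a I f) : ¬ BddAbove (f '' I) := by
  rintro ⟨B, hB⟩
  have hs := h.toIsSolution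
  have hB' : ∀ t ∈ I, f t ≤ B := fun t ht => hB (mem_image_of_mem f ht)
  set T := sSup I with hTdef
  have hbdd : BddAbove I := ⟨_, fun t ht => (hs.subset_Icc hn ht).2⟩
  have hlt : ∀ t ∈ I, t < T := by
    intro t ht
    obtain ⟨u, htu, hu⟩ := mem_nhdsGE_iff_exists_Ico_subset.1
      (mem_nhdsWithin_of_mem_nhds (hs.isOpen.mem_nhds ht) : I ∈ 𝓝[≥] t)
    have htu' : t < u := htu
    have : (t + u) / 2 ∈ I := hu ⟨by linarith, by linarith⟩
    linarith [le_csSup hbdd this]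
  have hT0 : 0 < T := hlt 0 hs.zero_mem
  have hI : Ico 0 T ⊆ I := by
    intro t ht
    obtain ⟨u, hu, htu⟩ := exists_lt_of_lt_csSup ⟨0, hs.zero_mem⟩ ht.2
    exact hs.ordConnected.out hs.zero_mem hu ⟨ht.1, htu.le⟩
  have hIoo : Ioo 0 T ⊆ I := Ioo_subset_Ico_self.trans hI
  have hne : (Ioo 0 T).Nonempty := nonempty_Ioo.2 hT0
  have hlim := ((hs.monotoneOn hn).mono (fun t ht => ⟨hIoo ht, ht.1.le⟩ :
    Ioo 0 T ⊆ I ∩ Ici 0)).tendsto_nhdsWithin_Ioo_left hne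
      ⟨B, by rintro _ ⟨t, ht, rfl⟩; exact hB' t (hIoo ht)⟩
  have hlim' := ((hs.deriv_monotoneOn hn).mono hIoo).tendsto_nhdsWithin_Ioo_left hne
      -- The first integral turns the bound `B` on `f` into a bound on `f'`.
      ⟨(Real.sinh B / Real.sinh a) ^ (n - 1), by
        rintro _ ⟨t, ht, rfl⟩
        have hst := hs.sinh_pos (hIoo ht)
        have hsa := hs.sinh_initial_pos
        have h1 : deriv f t ≤ √(1 + deriv f t ^ 2) :=
          Real.le_sqrt_of_sq_le (by linarith)
        rw [hs.sqrt_one_add_deriv_sq hn (hIoo ht)] at h1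
        refine h1.trans ?_
        gcongr
        exact Real.sinh_le_sinh.2 (hB' t (hIoo ht))⟩
  set L := sSup (f '' Ioo 0 T) with hLdef
  set M := sSup (deriv f '' Ioo 0 T) with hMdef
  have hL : 0 < L := by
    refine hs.initial_pos.trans_le (ge_of_tendsto hlim ?_)
    filter_upwards [Ioo_mem_nhdsLT hT0] with t ht using hs.initial_le hn (hIoo ht)
  obtain ⟨x, p, hx, hp, ε, hε, hxp⟩ := exists_local_solution ((n : ℝ) - 1) L M T hL
  have hTm : T ∈ Ioo (T - ε) (T + ε) := ⟨by linarith, by linarith⟩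
  set F : ℝ → ℝ := fun t => if t < T then f t else x t with hF
  set G : ℝ → ℝ := fun t => if t < T then deriv f t else p t with hG
  set J := I ∪ Ioo 0 (T + ε) with hJ
  have hFlt : ∀ t < T, F t = f t := fun t ht => by simp [hF, ht]
  have hGlt : ∀ t < T, G t = deriv f t := fun t ht => by simp [hG, ht]
  have hFge : ∀ t, T ≤ t → F t = x t := fun t ht => by simp [hF, not_lt.2 ht]
  have hGge : ∀ t, T ≤ t → G t = p t := fun t ht => by simp [hG, not_lt.2 ht]
  have hJlt : ∀ t ∈ J, t < T → t ∈ I := by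
    rintro t (ht | ht) htT
    · exact ht
    · exact hIoo ⟨ht.1, htT⟩
  have hJge : ∀ t ∈ J, T ≤ t → t ∈ Ioo (T - ε) (T + ε) := by
    rintro t (ht | ht) htT
    · exact absurd (hlt t ht) (not_lt.2 htT)
    · exact ⟨by linarith, ht.2⟩
  have hFd : ∀ t ∈ J, HasDerivAt F (G t) t := by
    intro t ht
    rcases lt_trichotomy t T with htT | rfl | htT
    · rw [hGlt t htT]
      refine (hs.hasDerivAt (hJlt t ht htT)).congr_of_eventuallyEq ?_
      filter_upwards [Iio_mem_nhds htT] with s hs using hFlt s hs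
    · rw [hGge _ le_rfl]
      -- At the junction the one-sided derivatives agree because the restarted solution takes the
      -- limits `L` and `M` as initial data.
      refine hasDerivAt_ite_lt (u' := deriv f) ?_ (by rwa [hx]) (by rwa [hp]) (hxp _ hTm).2.1
      filter_upwards [Ioo_mem_nhdsLT hT0] with t ht using hs.hasDerivAt (hIoo ht)
    · rw [hGge t htT.le]
      refine (hxp t (hJge t ht htT.le)).2.1.congr_of_eventuallyEq ?_
      filter_upwards [Ioi_mem_nhds htT] with s hs using hFge s (le_of_lt hs)
  have hGd : ∀ t ∈ J, HasDerivAt G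
      (((n : ℝ) - 1) * (Real.cosh (F t) / Real.sinh (F t)) * (1 + G t ^ 2)) t := by
    intro t ht
    rcases lt_trichotomy t T with htT | rfl | htT
    · rw [hGlt t htT, hFlt t htT]
      refine (hs.ode t (hJlt t ht htT)).congr_of_eventuallyEq ?_
      filter_upwards [Iio_mem_nhds htT] with s hs using hGlt s hs
    · rw [hGge _ le_rfl, hFge _ le_rfl]
      refine hasDerivAt_ite_lt (u' := fun t =>
        ((n : ℝ) - 1) * (Real.cosh (f t) / Real.sinh (f t)) * (1 + deriv f t ^ 2)) ?_
        (by rwa [hp]) ?_ (hxp _ hTm).2.2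
      · filter_upwards [Ioo_mem_nhdsLT hT0] with t ht using hs.ode t (hIoo ht)
      · rw [hx, hp]
        exact (tendsto_const_nhds.mul (((Real.continuous_cosh.tendsto L).comp hlim).div
          ((Real.continuous_sinh.tendsto L).comp hlim) (Real.sinh_pos_iff.2 hL).ne')).mul
          (tendsto_const_nhds.add (hlim'.pow 2))
    · rw [hGge t htT.le, hFge t htT.le]
      refine (hxp t (hJge t ht htT.le)).2.2.congr_of_eventuallyEq ?_
      filter_upwards [Ioi_mem_nhds htT] with s hs using hGge s (le_of_lt hs)
  have hJo : IsOpen J := hs.isOpen.union isOpen_Ioo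
  have hderiv : ∀ t ∈ J, deriv F t = G t := fun t ht => (hFd t ht).deriv
  have hsol : IsSolution n a J F :=
    { isOpen := hJo
      ordConnected := by
        rw [← isPreconnected_iff_ordConnected]
        have hmid : T / 2 ∈ Ioo 0 T := ⟨by linarith, by linarith⟩
        exact hs.convex.isPreconnected.union (T / 2) (hIoo hmid)
          ⟨hmid.1, by linarith⟩ isPreconnected_Ioo
      zero_mem := Or.inl hs.zero_mem
      pos := by
        intro t ht
        rcases lt_or_ge t T with htT | htT
        · rw [hFlt t htT]; exact hs.pos t (hJlt t ht htT)
        · rw [hFge t htT]; exact (hxp t (hJge t ht htT)).1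
      differentiableAt := fun t ht => (hFd t ht).differentiableAt
      ode := by
        intro t ht
        rw [hderiv t ht]
        refine (hGd t ht).congr_of_eventuallyEq ?_
        filter_upwards [hJo.mem_nhds ht] with s hs using hderiv s hs
      value_zero := by rw [hFlt 0 hT0, hs.value_zero]
      deriv_zero := by
        rw [hderiv 0 (Or.inl hs.zero_mem), hGlt 0 hT0, hs.deriv_zero] }
  have hTI : T ∈ I := h.maximal J F hsol subset_union_left (fun t ht => hFlt t (hlt t ht))
    (Or.inr ⟨hT0, by linarith⟩)
  exact lt_irrefl _ (hlt T hTI)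

/-! ### Integration in logarithmic polar coordinates -/

/-- Integration of radial functions in polar coordinates. -/
theorem lintegral_fun_norm {E : Type*} [NormedAddCommGroup E] [NormedSpace ℝ E]
    [MeasurableSpace E] [BorelSpace E] [Nontrivial E] [FiniteDimensional ℝ E] (μ : Measure E)
    [μ.IsAddHaarMeasure] {g : ℝ → ℝ≥0∞} (hg : Measurable g) :
    ∫⁻ y, g ‖y‖ ∂μ = μ.toSphere univ *
      ∫⁻ r in Ioi 0, ENNReal.ofReal (r ^ (Module.finrank ℝ E - 1)) * g r := by
  have hm := μ.measurePreserving_homeomorphUnitSphereProd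
  have h1 : ∫⁻ y, g ‖y‖ ∂μ = ∫⁻ y in ({0}ᶜ : Set E), g ‖y‖ ∂μ := by
    rw [restrict_compl_singleton]
  have h2 : ∫⁻ y in ({0}ᶜ : Set E), g ‖y‖ ∂μ =
      ∫⁻ y : ({0}ᶜ : Set E), g ‖(y : E)‖ ∂(μ.comap (↑)) :=
    (lintegral_subtype_comap (measurableSet_singleton (0 : E)).compl fun y => g ‖y‖).symm
  have hg' : Measurable fun r : Ioi (0 : ℝ) => g r := hg.comp measurable_subtype_coe
  have h3 : ∫⁻ y : ({0}ᶜ : Set E), g ‖(y : E)‖ ∂(μ.comap (↑)) =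
      ∫⁻ p, g (p.2 : ℝ) ∂(μ.toSphere.prod (Measure.volumeIoiPow (Module.finrank ℝ E - 1))) := by
    simpa using hm.lintegral_comp (hg'.comp measurable_snd)
  have h4 : ∫⁻ p, g (p.2 : ℝ)
      ∂(μ.toSphere.prod (Measure.volumeIoiPow (Module.finrank ℝ E - 1))) =
      μ.toSphere univ * ∫⁻ r, g (r : ℝ) ∂(Measure.volumeIoiPow (Module.finrank ℝ E - 1)) := by
    rw [← lintegral_map (f := fun r : Ioi (0 : ℝ) => g r) hg' measurable_snd,
      Measure.map_snd_prod, lintegral_smul_measure, smul_eq_mul]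
  rw [h1, h2, h3, h4, Measure.volumeIoiPow, lintegral_withDensity_eq_lintegral_mul _
    (by fun_prop) hg']
  congr 1
  exact lintegral_subtype_comap measurableSet_Ioi
    fun r : ℝ => ENNReal.ofReal (r ^ (Module.finrank ℝ E - 1)) * g r

theorem measurableSet_annulus (n : ℕ) {I : Set ℝ} (hI : MeasurableSet I) :
    MeasurableSet (annulus n I) :=
  (measurableSet_singleton 0).compl.inter
    ((Real.measurable_log.comp measurable_norm) hI)

/-- Integration over an annulus in logarithmic polar coordinates. -/
theorem lintegral_annulus {n : ℕ} (hn : 2 ≤ n) {I : Set ℝ} (hI : MeasurableSet I)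
    {F : ℝ → ℝ≥0∞} (hF : Measurable F) :
    ∫⁻ y in annulus n I, ENNReal.ofReal ((‖y‖ ^ n)⁻¹) * F (Real.log ‖y‖) =
      (volume : Measure (EuclideanSpace ℝ (Fin n))).toSphere univ * ∫⁻ t in I, F t := by
  have : Nontrivial (EuclideanSpace ℝ (Fin n)) := by
    have : NeZero n := ⟨by omega⟩
    infer_instance
  set g : ℝ → ℝ≥0∞ := fun r =>
    ENNReal.ofReal ((r ^ n)⁻¹) * I.indicator F (Real.log r) with hg
  have hFi : Measurable (I.indicator F) := hF.indicator hI
  have hgm : Measurable g := by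
    refine Measurable.mul (by fun_prop) (hFi.comp Real.measurable_log)
  have h1 : ∫⁻ y in annulus n I, ENNReal.ofReal ((‖y‖ ^ n)⁻¹) * F (Real.log ‖y‖) =
      ∫⁻ y : EuclideanSpace ℝ (Fin n), g ‖y‖ := by
    rw [← lintegral_indicator (measurableSet_annulus n hI)]
    refine lintegral_congr_ae ?_
    filter_upwards [compl_mem_ae_iff.2 (measure_singleton (0 : EuclideanSpace ℝ (Fin n)))]
      with y hy
    by_cases hy' : Real.log ‖y‖ ∈ I
    · have : y ∈ annulus n I := ⟨hy, hy'⟩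
      simp [hg, hy', this]
    · have : y ∉ annulus n I := fun h => hy' h.2
      simp [hg, hy', this]
  rw [h1, lintegral_fun_norm _ hgm]
  congr 1
  -- Substitute `r = eᵗ`: then `r^(n-1) dr = eⁿᵗ dt`, and the factor `‖y‖⁻ⁿ` cancels `eⁿᵗ`.
  have himg : Ioi (0 : ℝ) = Real.exp '' univ := by rw [image_univ, Real.range_exp]
  rw [himg, lintegral_image_eq_lintegral_abs_deriv_mul MeasurableSet.univ
    (fun x _ => (Real.hasDerivAt_exp x).hasDerivWithinAt) Real.exp_injective.injOn,
    Measure.restrict_univ, ← lintegral_indicator hI]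
  refine lintegral_congr fun t => ?_
  simp only [hg, Real.log_exp, finrank_euclideanSpace, Fintype.card_fin]
  rw [← mul_assoc, ← mul_assoc, ← ENNReal.ofReal_mul (abs_nonneg _), ← ENNReal.ofReal_mul
    (by positivity), abs_of_pos (Real.exp_pos t), ← pow_succ', Nat.sub_add_cancel (by omega),
    mul_inv_cancel₀ (by positivity), ENNReal.ofReal_one, one_mul]

theorem toSphere_univ_ne_zero {n : ℕ} (hn : 2 ≤ n) :
    (volume : Measure (EuclideanSpace ℝ (Fin n))).toSphere univ ≠ 0 := by
  have : NeZero n := ⟨by omega⟩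
  exact Measure.measure_univ_ne_zero.2 (Measure.toSphere_ne_zero _)

/-- The integral of the absolute value of the derivative is infinite when the function is
unbounded. -/
theorem lintegral_abs_deriv_eq_top {I : Set ℝ} {f f' : ℝ → ℝ} (hI : I.OrdConnected)
    (hne : I.Nonempty) (hf : ∀ t ∈ I, HasDerivAt f (f' t) t) (hf' : ContinuousOn f' I)
    (hub : ¬ BddAbove (f '' I)) : ∫⁻ t in I, ENNReal.ofReal |f' t| = ∞ := by
  by_contra hfin
  obtain ⟨s, hs⟩ := hne
  -- A finite total variation would bound every increment `f t - f s`.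
  refine hub ⟨f s + (∫⁻ t in I, ENNReal.ofReal |f' t|).toReal, ?_⟩
  rintro _ ⟨t, ht, rfl⟩
  have hsub : uIcc s t ⊆ I := hI.uIcc_subset hs ht
  have hint : IntervalIntegrable f' volume s t := (hf'.mono hsub).intervalIntegrable
  have heq := intervalIntegral.integral_eq_sub_of_hasDerivAt (fun x hx => hf x (hsub hx)) hint
  have h1 : f t - f s ≤ ∫ x in uIoc s t, |f' x| := by
    rw [← heq]
    refine (le_abs_self _).trans ?_
    simpa using intervalIntegral.norm_integral_le_integral_norm_uIoc (f := f')
  have h2 : ∫ x in uIoc s t, |f' x| = (∫⁻ x in uIoc s t, ENNReal.ofReal |f' x|).toReal :=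
    integral_eq_lintegral_of_nonneg_ae (Eventually.of_forall fun x => abs_nonneg _)
      (intervalIntegrable_iff.1 hint).abs.aestronglyMeasurable
  have h3 : (∫⁻ x in uIoc s t, ENNReal.ofReal |f' x|).toReal ≤
      (∫⁻ t in I, ENNReal.ofReal |f' t|).toReal :=
    ENNReal.toReal_mono hfin (lintegral_mono_set (uIoc_subset_uIcc.trans hsub))
  linarith

/-! ### Linear algebra of rotationally invariant bilinear forms -/

open Matrix

/-- The matrix of the bilinear form `α ⟨u, v⟩ + β ⟨y, u⟩ ⟨y, v⟩`. -/
def radialMatrix {n : ℕ} (y : EuclideanSpace ℝ (Fin n)) (α β : ℝ) : Matrix (Fin n) (Fin n) ℝ :=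
  α • 1 + β • vecMulVec y.ofLp y.ofLp

section RadialMatrix

variable {n : ℕ} (y : EuclideanSpace ℝ (Fin n))

theorem dotProduct_ofLp_self : y.ofLp ⬝ᵥ y.ofLp = ‖y‖ ^ 2 := by
  rw [EuclideanSpace.norm_sq_eq, dotProduct]
  exact Finset.sum_congr rfl fun i _ => by rw [Real.norm_eq_abs, sq_abs, sq]

/-- The rank one matrix squares to `‖y‖²` times itself, so these matrices form a commutative
algebra. Each acts as `α` on the complement of `y` and as `α + β ‖y‖²` on `y`, which explains the
inverse, determinant and trace below. -/
theorem radialMatrix_mul (α β α' β' : ℝ) :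
    radialMatrix y α β * radialMatrix y α' β' =
      radialMatrix y (α * α') (α * β' + β * α' + β * β' * ‖y‖ ^ 2) := by
  have h : vecMulVec y.ofLp y.ofLp * vecMulVec y.ofLp y.ofLp =
      (‖y‖ ^ 2) • vecMulVec y.ofLp y.ofLp := by
    rw [vecMulVec_mul_vecMulVec, dotProduct_ofLp_self, vecMulVec_smul]
  simp only [radialMatrix, add_mul, mul_add, smul_mul_assoc, mul_smul_comm, one_mul, mul_one, h]
  module

theorem trace_radialMatrix (α β : ℝ) : (radialMatrix y α β).trace = n * α + β * ‖y‖ ^ 2 := by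
  simp [radialMatrix, trace_add, trace_smul, trace_vecMulVec, dotProduct_ofLp_self, mul_comm]

theorem inv_radialMatrix {α β : ℝ} (hα : α ≠ 0) (hαβ : α + β * ‖y‖ ^ 2 ≠ 0) :
    (radialMatrix y α β)⁻¹ = radialMatrix y α⁻¹ (-β / (α * (α + β * ‖y‖ ^ 2))) := by
  refine inv_eq_right_inv ?_
  rw [radialMatrix_mul]
  have : α * (-β / (α * (α + β * ‖y‖ ^ 2))) + β * α⁻¹ +
      β * (-β / (α * (α + β * ‖y‖ ^ 2))) * ‖y‖ ^ 2 = 0 := by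
    field_simp
    ring
  rw [this, mul_inv_cancel₀ hα]
  simp [radialMatrix]

theorem det_radialMatrix (hn : 1 ≤ n) {α : ℝ} (hα : α ≠ 0) (β : ℝ) :
    (radialMatrix y α β).det = α ^ (n - 1) * (α + β * ‖y‖ ^ 2) := by
  have h : radialMatrix y α β =
      α • (1 + replicateCol Unit ((β / α) • y.ofLp) * replicateRow Unit y.ofLp) := by
    rw [← vecMulVec_eq, smul_vecMulVec, smul_add, smul_smul, mul_div_cancel₀ _ hα]
    rfl
  rw [h, det_smul, det_one_add_replicateCol_mul_replicateRow, dotProduct_smul,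
    dotProduct_ofLp_self, Fintype.card_fin]
  obtain ⟨k, rfl⟩ : ∃ k, n = k + 1 := ⟨n - 1, by omega⟩
  simp only [Nat.add_sub_cancel, pow_succ, smul_eq_mul]
  field_simp

/-- Applied to the metric and the second fundamental form, the two quotients are the principal
curvatures: the first along the sphere, with multiplicity `n - 1`, the second along the meridian. -/
theorem trace_sq_inv_mul_radialMatrix {α β : ℝ} (hα : α ≠ 0) (hαβ : α + β * ‖y‖ ^ 2 ≠ 0)
    (α' β' : ℝ) :
    (((radialMatrix y α β)⁻¹ * radialMatrix y α' β') ^ 2).trace =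
      ((n : ℝ) - 1) * (α' / α) ^ 2 + ((α' + β' * ‖y‖ ^ 2) / (α + β * ‖y‖ ^ 2)) ^ 2 := by
  rw [inv_radialMatrix y hα hαβ, radialMatrix_mul, sq, radialMatrix_mul, trace_radialMatrix]
  field_simp
  ring

theorem inner_stdVec (i j : Fin n) :
    inner ℝ (stdVec i) (stdVec j : EuclideanSpace ℝ (Fin n)) =
      (1 : Matrix (Fin n) (Fin n) ℝ) i j := by
  simp [stdVec, EuclideanSpace.inner_single_left, Matrix.one_apply]

theorem inner_stdVec_right (i : Fin n) : inner ℝ y (stdVec i) = y.ofLp i := by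
  simp [stdVec, EuclideanSpace.inner_single_right]

theorem coordMatrix_eq_radialMatrix {b : EuclideanSpace ℝ (Fin n) → EuclideanSpace ℝ (Fin n) → ℝ}
    {α β : ℝ} (hb : ∀ u v, b u v = α * inner ℝ u v + β * (inner ℝ y u * inner ℝ y v)) :
    coordMatrix b = radialMatrix y α β := by
  ext i j
  simp only [coordMatrix, of_apply, hb, inner_stdVec, inner_stdVec_right y, radialMatrix,
    Matrix.add_apply, Matrix.smul_apply, vecMulVec_apply, smul_eq_mul]

end RadialMatrix

/-! ### Radial derivatives and the ambient connection -/

section Radial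

variable {E : Type*} [NormedAddCommGroup E] [InnerProductSpace ℝ E]

theorem hasFDerivAt_log_norm {y : E} (hy : y ≠ 0) :
    HasFDerivAt (fun q : E => Real.log ‖q‖) ((‖y‖ ^ 2)⁻¹ • innerSL ℝ y) y := by
  have h1 : HasFDerivAt (fun q : E => ‖q‖ ^ 2) (2 • innerSL ℝ y) y :=
    (hasStrictFDerivAt_norm_sq y).hasFDerivAt
  have h0 : ‖y‖ ^ 2 ≠ 0 := by simpa using hy
  have h2 := (h1.log h0).const_mul (1 / 2 : ℝ)
  have h3 : (fun q : E => Real.log ‖q‖) = fun q : E => 1 / 2 * Real.log (‖q‖ ^ 2) := by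
    funext q
    rw [Real.log_pow]
    push_cast
    ring
  rw [h3]
  refine h2.congr_fderiv ?_
  ext u
  simp
  ring

theorem hasFDerivAt_radial {y : E} (hy : y ≠ 0) {P : ℝ → ℝ} {p : ℝ}
    (hP : HasDerivAt P p (Real.log ‖y‖)) :
    HasFDerivAt (fun q : E => P (Real.log ‖q‖)) ((p / ‖y‖ ^ 2) • innerSL ℝ y) y := by
  refine (hP.comp_hasFDerivAt y (hasFDerivAt_log_norm hy)).congr_fderiv ?_
  rw [smul_smul, div_eq_mul_inv]

theorem isOpen_setOf_log_norm_mem {I : Set ℝ} (hI : IsOpen I) :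
    IsOpen {y : E | y ≠ 0 ∧ Real.log ‖y‖ ∈ I} := by
  have h : ContinuousOn (fun y : E => Real.log ‖y‖) {0}ᶜ := fun y hy =>
    (hasFDerivAt_log_norm hy).continuousAt.continuousWithinAt
  exact h.isOpen_inter_preimage isOpen_compl_singleton hI

end Radial

theorem isOpen_annulus (n : ℕ) {I : Set ℝ} (hI : IsOpen I) : IsOpen (annulus n I) :=
  isOpen_setOf_log_norm_mem hI

/-- Only the conformal factor varies: `(2/(1-s))²` has derivative `8/(1-s)³` in `s = ‖x‖²`, whose
differential is `2⟨x, ·⟩`, and the Koszul formula halves the resulting 16. -/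
theorem christoffel_ambientMetric {n : ℕ} {p : EuclideanSpace ℝ (Fin n) × ℝ} (hp : ‖p.1‖ ^ 2 < 1)
    (u v w : EuclideanSpace ℝ (Fin n) × ℝ) :
    christoffel (ambientMetric n) p u v w = 8 / (1 - ‖p.1‖ ^ 2) ^ 3 *
      (inner ℝ p.1 u.1 * inner ℝ v.1 w.1 + inner ℝ p.1 v.1 * inner ℝ u.1 w.1
        - inner ℝ p.1 w.1 * inner ℝ u.1 v.1) := by
  have h1 : 1 - ‖p.1‖ ^ 2 ≠ 0 := by linarith
  have key : ∀ u v w : EuclideanSpace ℝ (Fin n) × ℝ,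
      fderiv ℝ (fun q => ambientMetric n q v w) p u =
        16 / (1 - ‖p.1‖ ^ 2) ^ 3 * inner ℝ p.1 u.1 * inner ℝ v.1 w.1 := by
    intro u v w
    have hs : HasFDerivAt (fun q : EuclideanSpace ℝ (Fin n) × ℝ => ‖q.1‖ ^ 2)
        ((2 • innerSL ℝ p.1).comp (ContinuousLinearMap.fst ℝ _ _)) p :=
      (hasStrictFDerivAt_norm_sq p.1).hasFDerivAt.comp p hasFDerivAt_fst
    have hd : HasDerivAt (fun s : ℝ => (2 / (1 - s)) ^ 2 * inner ℝ v.1 w.1 + v.2 * w.2)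
        (8 / (1 - ‖p.1‖ ^ 2) ^ 3 * inner ℝ v.1 w.1) (‖p.1‖ ^ 2) := by
      have h2 : HasDerivAt (fun s : ℝ => 1 - s) (-1) (‖p.1‖ ^ 2) :=
        (hasDerivAt_id _).const_sub 1
      refine (((((hasDerivAt_const _ (2 : ℝ)).fun_div h2 h1).fun_pow 2).mul_const
        (inner ℝ v.1 w.1)).add_const (v.2 * w.2)).congr_deriv ?_
      have h3 : (1 - ‖p.1‖ ^ 2)⁻¹ * (1 - ‖p.1‖ ^ 2) = 1 := inv_mul_cancel₀ h1
      simp only [Nat.cast_ofNat]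
      field_simp
      linear_combination 8 * inner ℝ v.1 w.1 * h3
    have h3 := (hd.comp_hasFDerivAt p hs).fderiv
    have h4 : (fun q => ambientMetric n q v w) =
        (fun s : ℝ => (2 / (1 - s)) ^ 2 * inner ℝ v.1 w.1 + v.2 * w.2) ∘
          fun q : EuclideanSpace ℝ (Fin n) × ℝ => ‖q.1‖ ^ 2 := rfl
    rw [h4, h3]
    simp
    ring
  rw [christoffel, key, key, key]
  ring

/-! ### Hypersurfaces of revolution in the ball model -/

/-- The hypersurface of revolution with generating curve `t ↦ (b(t), t)`, in the chart
`y ↦ (log ‖y‖, y / ‖y‖)`. -/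
def revolutionChart {n : ℕ} (b : ℝ → ℝ) (y : EuclideanSpace ℝ (Fin n)) :
    EuclideanSpace ℝ (Fin n) × ℝ :=
  (b (Real.log ‖y‖) • ‖y‖⁻¹ • y, Real.log ‖y‖)

/-- `b₁` and `b₂` are the first and second derivatives of the profile `b` on `I`, and the profile
stays inside the punctured ball. -/
structure IsProfile (I : Set ℝ) (b b₁ b₂ : ℝ → ℝ) : Prop where
  isOpen : IsOpen I
  pos : ∀ t ∈ I, 0 < b t
  lt_one : ∀ t ∈ I, b t < 1
  hasDerivAt : ∀ t ∈ I, HasDerivAt b (b₁ t) t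
  hasDerivAt' : ∀ t ∈ I, HasDerivAt b₁ (b₂ t) t

theorem exp_neg_log {r : ℝ} (hr : 0 < r) : Real.exp (-Real.log r) = r⁻¹ := by
  rw [Real.exp_neg, Real.exp_log hr]

theorem exp_neg_nat_mul_log {r : ℝ} (hr : 0 < r) (k : ℕ) :
    Real.exp (-(k * Real.log r)) = (r ^ k)⁻¹ := by
  rw [Real.exp_neg, Real.exp_nat_mul, Real.exp_log hr]

/-- With `t = log ‖y‖`, dividing by `‖y‖ ^ c` is multiplying by `e^(-ct)`; this one rule
differentiates all the radial coefficients that follow. -/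
theorem hasDerivAt_mul_exp_neg {b : ℝ → ℝ} {b' t : ℝ} (h : HasDerivAt b b' t) (c : ℝ) :
    HasDerivAt (fun t => b t * Real.exp (-(c * t))) ((b' - c * b t) * Real.exp (-(c * t))) t := by
  refine (h.mul ((hasDerivAt_id t).const_mul c).neg.exp).congr_deriv ?_
  simp
  ring

namespace IsProfile

variable {n : ℕ} {I : Set ℝ} {b b₁ b₂ : ℝ → ℝ}

theorem sq_lt_one (h : IsProfile I b b₁ b₂) {t : ℝ} (ht : t ∈ I) : b t ^ 2 < 1 := by
  nlinarith [h.pos t ht, h.lt_one t ht]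

theorem fderiv_revolutionChart (h : IsProfile I b b₁ b₂) {y : EuclideanSpace ℝ (Fin n)}
    (hy : y ∈ annulus n I) (u : EuclideanSpace ℝ (Fin n)) :
    fderiv ℝ (revolutionChart b) y u =
      (((b₁ (Real.log ‖y‖) - b (Real.log ‖y‖)) / ‖y‖ ^ 3 * inner ℝ y u) • y
        + (b (Real.log ‖y‖) / ‖y‖) • u, (‖y‖ ^ 2)⁻¹ * inner ℝ y u) := by
  obtain ⟨hy0, hyI⟩ := hy
  have hr : 0 < ‖y‖ := norm_pos_iff.2 hy0
  have hP := hasDerivAt_mul_exp_neg (h.hasDerivAt _ hyI) 1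
  have h1 := ((hasFDerivAt_radial hy0 hP).fun_smul (hasFDerivAt_id y)).prodMk
    (hasFDerivAt_log_norm hy0)
  have h2 : revolutionChart b =ᶠ[𝓝 y] fun q =>
      ((b (Real.log ‖q‖) * Real.exp (-(1 * Real.log ‖q‖))) • id q, Real.log ‖q‖) := by
    filter_upwards [isOpen_ne.mem_nhds hy0] with q hq
    have hq' : 0 < ‖q‖ := norm_pos_iff.2 hq
    simp [revolutionChart, exp_neg_log hq', smul_smul]
  rw [h2.fderiv_eq, h1.fderiv, one_mul, one_mul, exp_neg_log hr]
  ext1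
  · simp only [ContinuousLinearMap.prod_apply, _root_.add_apply,
      _root_.smul_apply, ContinuousLinearMap.smulRight_apply, innerSL_apply_apply,
      ContinuousLinearMap.id_apply, id, smul_eq_mul]
    rw [add_comm]
    congr 2
    field_simp
  · simp

theorem fderiv_fderiv_revolutionChart (h : IsProfile I b b₁ b₂) {y : EuclideanSpace ℝ (Fin n)}
    (hy : y ∈ annulus n I) (u v : EuclideanSpace ℝ (Fin n)) :
    fderiv ℝ (fun q => fderiv ℝ (revolutionChart b) q v) y u =
      (((b₂ (Real.log ‖y‖) - 4 * b₁ (Real.log ‖y‖) + 3 * b (Real.log ‖y‖)) / ‖y‖ ^ 5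
            * inner ℝ y u * inner ℝ y v
          + (b₁ (Real.log ‖y‖) - b (Real.log ‖y‖)) / ‖y‖ ^ 3 * inner ℝ u v) • y
        + ((b₁ (Real.log ‖y‖) - b (Real.log ‖y‖)) / ‖y‖ ^ 3 * inner ℝ y v) • u
        + ((b₁ (Real.log ‖y‖) - b (Real.log ‖y‖)) / ‖y‖ ^ 3 * inner ℝ y u) • v,
        (‖y‖ ^ 2)⁻¹ * inner ℝ u v - 2 / ‖y‖ ^ 4 * inner ℝ y u * inner ℝ y v) := by
  have hA := hy
  obtain ⟨hy0, hyI⟩ := hy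
  have hr : 0 < ‖y‖ := norm_pos_iff.2 hy0
  have hP := hasDerivAt_mul_exp_neg (h.hasDerivAt _ hyI) 1
  have hQ := hasDerivAt_mul_exp_neg ((h.hasDerivAt' _ hyI).fun_sub (h.hasDerivAt _ hyI)) (3 : ℕ)
  have hT := hasDerivAt_mul_exp_neg (hasDerivAt_const (Real.log ‖y‖) (1 : ℝ)) (2 : ℕ)
  have hv : HasFDerivAt (fun q : EuclideanSpace ℝ (Fin n) => inner ℝ q v) (innerSL ℝ v) y := by
    simp only [real_inner_comm v]
    exact (innerSL ℝ v).hasFDerivAt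
  have h1 := ((((hasFDerivAt_radial hy0 hQ).fun_mul hv).fun_smul (hasFDerivAt_id y)).fun_add
    ((hasFDerivAt_radial hy0 hP).fun_smul (hasFDerivAt_const v y))).prodMk
    ((hasFDerivAt_radial hy0 hT).fun_mul hv)
  have h2 : (fun q => fderiv ℝ (revolutionChart b) q v) =ᶠ[𝓝 y] fun q =>
      (((b₁ (Real.log ‖q‖) - b (Real.log ‖q‖)) * Real.exp (-((3 : ℕ) * Real.log ‖q‖))
          * inner ℝ q v) • id q + (b (Real.log ‖q‖) * Real.exp (-(1 * Real.log ‖q‖))) • v,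
        1 * Real.exp (-((2 : ℕ) * Real.log ‖q‖)) * inner ℝ q v) := by
    filter_upwards [(isOpen_annulus n h.isOpen).mem_nhds hA] with q hq
    have hq' : 0 < ‖q‖ := norm_pos_iff.2 hq.1
    rw [h.fderiv_revolutionChart hq, exp_neg_nat_mul_log hq', exp_neg_nat_mul_log hq', one_mul,
      one_mul, exp_neg_log hq', div_eq_mul_inv, div_eq_mul_inv]
    rfl
  rw [h2.fderiv_eq, h1.fderiv, one_mul, one_mul, exp_neg_log hr, exp_neg_nat_mul_log hr,
    exp_neg_nat_mul_log hr]
  ext1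
  · simp only [ContinuousLinearMap.prod_apply, _root_.add_apply,
      _root_.smul_apply, ContinuousLinearMap.smulRight_apply, innerSL_apply_apply,
      ContinuousLinearMap.id_apply, id, smul_eq_mul, smul_zero,
      zero_add]
    rw [real_inner_comm u v]
    match_scalars <;> field_simp <;> ring
  · simp only [ContinuousLinearMap.prod_apply, _root_.add_apply,
      _root_.smul_apply, innerSL_apply_apply, smul_eq_mul]
    rw [real_inner_comm u v]
    push_cast
    field_simp
    ring

theorem norm_fst_revolutionChart_sq {y : EuclideanSpace ℝ (Fin n)} (hy : y ≠ 0) :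
    ‖(revolutionChart b y).1‖ ^ 2 = b (Real.log ‖y‖) ^ 2 := by
  have hr : 0 < ‖y‖ := norm_pos_iff.2 hy
  simp [revolutionChart, norm_smul, hr.ne']

theorem inducedMetric_revolutionChart (h : IsProfile I b b₁ b₂) {y : EuclideanSpace ℝ (Fin n)}
    (hy : y ∈ annulus n I) (u v : EuclideanSpace ℝ (Fin n)) :
    inducedMetric (revolutionChart b) y u v =
      (2 / (1 - b (Real.log ‖y‖) ^ 2)) ^ 2 * b (Real.log ‖y‖) ^ 2 / ‖y‖ ^ 2 * inner ℝ u v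
      + ((2 / (1 - b (Real.log ‖y‖) ^ 2)) ^ 2 * (b₁ (Real.log ‖y‖) ^ 2 - b (Real.log ‖y‖) ^ 2) + 1)
        / ‖y‖ ^ 4 * (inner ℝ y u * inner ℝ y v) := by
  have hr : 0 < ‖y‖ := norm_pos_iff.2 hy.1
  rw [inducedMetric, ambientMetric, h.fderiv_revolutionChart hy, h.fderiv_revolutionChart hy,
    norm_fst_revolutionChart_sq hy.1]
  simp only [inner_add_left, inner_add_right, real_inner_smul_left, real_inner_smul_right,
    real_inner_self_eq_norm_sq, real_inner_comm y u]
  generalize (2 / (1 - b (Real.log ‖y‖) ^ 2)) ^ 2 = l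
  field_simp
  ring

/-- A vector orthogonal to the hypersurface of revolution is a multiple of the obvious one. -/
theorem exists_of_normal (h : IsProfile I b b₁ b₂) {y : EuclideanSpace ℝ (Fin n)}
    (hy : y ∈ annulus n I) {N : EuclideanSpace ℝ (Fin n) × ℝ}
    (hN : ∀ u, ambientMetric n (revolutionChart b y) (fderiv ℝ (revolutionChart b) y u) N = 0) :
    ∃ c : ℝ, N = (c • y, -((2 / (1 - b (Real.log ‖y‖) ^ 2)) ^ 2 * b₁ (Real.log ‖y‖) * c * ‖y‖)) := by
  have hr : 0 < ‖y‖ := norm_pos_iff.2 hy.1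
  have hb := h.pos _ hy.2
  have hl : 0 < (2 / (1 - b (Real.log ‖y‖) ^ 2)) ^ 2 := by
    have := h.sq_lt_one hy.2
    have : 0 < 1 - b (Real.log ‖y‖) ^ 2 := by linarith
    positivity
  simp only [ambientMetric, h.fderiv_revolutionChart hy, norm_fst_revolutionChart_sq hy.1,
    inner_add_left, real_inner_smul_left] at hN
  generalize (2 / (1 - b (Real.log ‖y‖) ^ 2)) ^ 2 = l at *
  have hy1 : N.1 = (inner ℝ y N.1 / ‖y‖ ^ 2) • y := by
    rw [← sub_eq_zero, ← inner_self_eq_zero (𝕜 := ℝ)]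
    -- The part of `N.1` orthogonal to `y` is itself a test direction, tangent to the sphere, so it
    -- vanishes. Testing with `y` afterwards fixes the vertical component.
    set w := N.1 - (inner ℝ y N.1 / ‖y‖ ^ 2) • y with hw
    have hyw : inner ℝ y w = 0 := by
      rw [hw, inner_sub_right, real_inner_smul_right, real_inner_self_eq_norm_sq]
      field_simp
      ring
    have h1 := hN w
    rw [hyw] at h1
    have h2 : inner ℝ w N.1 = 0 := by
      have h3 : l * (b (Real.log ‖y‖) / ‖y‖) * inner ℝ w N.1 = 0 := by linear_combination h1
      exact (mul_eq_zero.1 h3).resolve_left (by positivity)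
    conv_lhs => arg 3; rw [hw]
    rw [inner_sub_right, real_inner_smul_right, real_inner_comm y w, hyw, h2]
    simp
  refine ⟨inner ℝ y N.1 / ‖y‖ ^ 2, Prod.ext hy1 ?_⟩
  have h1 := hN y
  rw [real_inner_self_eq_norm_sq] at h1
  field_simp at h1 ⊢
  linear_combination h1

/-- The second fundamental form of a hypersurface of revolution. -/
theorem secondForm_revolutionChart (h : IsProfile I b b₁ b₂) {y : EuclideanSpace ℝ (Fin n)}
    (hy : y ∈ annulus n I) {N : EuclideanSpace ℝ (Fin n) → EuclideanSpace ℝ (Fin n) × ℝ} {c : ℝ}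
    (hN : N y = (c • y, -((2 / (1 - b (Real.log ‖y‖) ^ 2)) ^ 2 * b₁ (Real.log ‖y‖) * c * ‖y‖)))
    (u v : EuclideanSpace ℝ (Fin n)) :
    secondForm (revolutionChart b) N y u v =
      (2 / (1 - b (Real.log ‖y‖) ^ 2)) ^ 2 * c / ‖y‖ *
      (-(b (Real.log ‖y‖) * (1 + b (Real.log ‖y‖) ^ 2) / (1 - b (Real.log ‖y‖) ^ 2)) * inner ℝ u v
      + (b₂ (Real.log ‖y‖) + 2 / (1 - b (Real.log ‖y‖) ^ 2) * b (Real.log ‖y‖)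
          * b₁ (Real.log ‖y‖) ^ 2
          + b (Real.log ‖y‖) * (1 + b (Real.log ‖y‖) ^ 2) / (1 - b (Real.log ‖y‖) ^ 2)) / ‖y‖ ^ 2
        * (inner ℝ y u * inner ℝ y v)) := by
  have hr : 0 < ‖y‖ := norm_pos_iff.2 hy.1
  have hb1 : 1 - b (Real.log ‖y‖) ^ 2 ≠ 0 := by linarith [h.sq_lt_one hy.2]
  have hX : (revolutionChart b y).1 = (b (Real.log ‖y‖) / ‖y‖) • y := by
    simp [revolutionChart, smul_smul, div_eq_mul_inv]
  rw [secondForm, christoffel_ambientMetric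
    (by rw [norm_fst_revolutionChart_sq hy.1]; exact h.sq_lt_one hy.2), ambientMetric,
    h.fderiv_fderiv_revolutionChart hy, h.fderiv_revolutionChart hy, h.fderiv_revolutionChart hy,
    norm_fst_revolutionChart_sq hy.1, hN, hX]
  simp only [inner_add_left, inner_add_right, real_inner_smul_left, real_inner_smul_right,
    real_inner_self_eq_norm_sq, real_inner_comm y u, real_inner_comm y v]
  field_simp
  ring

end IsProfile

/-! ### Half-angle identities for the ball model -/

theorem hasDerivAt_tanh (x : ℝ) : HasDerivAt Real.tanh (1 - Real.tanh x ^ 2) x := by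
  have h : Real.tanh = fun x => Real.sinh x / Real.cosh x := funext Real.tanh_eq_sinh_div_cosh
  have hc := (Real.cosh_pos x).ne'
  rw [h]
  refine ((Real.hasDerivAt_sinh x).fun_div (Real.hasDerivAt_cosh x) hc).congr_deriv ?_
  field_simp

theorem tanh_half_pos {x : ℝ} (hx : 0 < x) : 0 < Real.tanh (x / 2) := by
  rw [Real.tanh_eq_sinh_div_cosh]
  exact div_pos (Real.sinh_pos_iff.2 (by linarith)) (Real.cosh_pos _)

theorem tanh_half_lt_one (x : ℝ) : Real.tanh (x / 2) < 1 := by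
  rw [Real.tanh_eq_sinh_div_cosh, div_lt_one (Real.cosh_pos _)]
  exact Real.sinh_lt_cosh _

theorem one_sub_tanh_half_sq (x : ℝ) :
    1 - Real.tanh (x / 2) ^ 2 = 1 / Real.cosh (x / 2) ^ 2 := by
  have hc := (Real.cosh_pos (x / 2)).ne'
  rw [Real.tanh_eq_sinh_div_cosh]
  field_simp
  linarith [Real.cosh_sq (x / 2)]

/-- The sphere of Euclidean radius `tanh(x/2)` is the hyperbolic sphere of radius `x`, which is
isometric to a round sphere of radius `sinh x`. -/
theorem conformal_factor_mul_tanh_half_sq (x : ℝ) :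
    (2 / (1 - Real.tanh (x / 2) ^ 2)) ^ 2 * Real.tanh (x / 2) ^ 2 = Real.sinh x ^ 2 := by
  have hc := (Real.cosh_pos (x / 2)).ne'
  have hs : Real.sinh x = 2 * Real.sinh (x / 2) * Real.cosh (x / 2) := by
    rw [← Real.sinh_two_mul]; ring_nf
  rw [one_sub_tanh_half_sq, Real.tanh_eq_sinh_div_cosh, hs]
  field_simp

theorem one_add_tanh_half_sq_div (x : ℝ) :
    (1 + Real.tanh (x / 2) ^ 2) / (1 - Real.tanh (x / 2) ^ 2) = Real.cosh x := by
  have hc := (Real.cosh_pos (x / 2)).ne'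
  have hs : Real.cosh x = Real.cosh (x / 2) ^ 2 + Real.sinh (x / 2) ^ 2 := by
    rw [← Real.cosh_two_mul]; ring_nf
  rw [one_sub_tanh_half_sq, Real.tanh_eq_sinh_div_cosh, hs]
  field_simp

theorem rotationChart_eq (n : ℕ) (f : ℝ → ℝ) :
    rotationChart n f = revolutionChart fun t => Real.tanh (f t / 2) := rfl

/-! ### Metric and second fundamental form of the catenoid -/

namespace IsSolution

variable {n : ℕ} {a : ℝ} {I : Set ℝ} {f : ℝ → ℝ}

theorem isProfile (h : IsSolution n a I f) :
    IsProfile I (fun t => Real.tanh (f t / 2))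
      (fun t => (1 - Real.tanh (f t / 2) ^ 2) / 2 * deriv f t)
      (fun t => (1 - Real.tanh (f t / 2) ^ 2) / 2 *
        (((n : ℝ) - 1) * (Real.cosh (f t) / Real.sinh (f t)) * (1 + deriv f t ^ 2)
          - Real.tanh (f t / 2) * deriv f t ^ 2)) := by
  have hd : ∀ t ∈ I, HasDerivAt (fun t => Real.tanh (f t / 2))
      ((1 - Real.tanh (f t / 2) ^ 2) / 2 * deriv f t) t := by
    intro t ht
    refine ((hasDerivAt_tanh (f t / 2)).comp t ((h.hasDerivAt ht).div_const 2)).congr_deriv ?_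
    ring
  refine ⟨h.isOpen, fun t ht => tanh_half_pos (h.pos t ht), fun t _ => tanh_half_lt_one _, hd,
    fun t ht => ?_⟩
  refine (((((hd t ht).fun_pow 2).const_sub 1).div_const 2).fun_mul (h.ode t ht)).congr_deriv ?_
  push_cast
  ring

/-- This is `(1 + f'²) dt² + sinh² f dξ²`, with `dt = ⟨y, ·⟩ / ‖y‖²` and `dξ²` the remaining part of
the Euclidean metric divided by `‖y‖²`. -/
theorem inducedMetric_rotationChart (h : IsSolution n a I f) {y : EuclideanSpace ℝ (Fin n)}
    (hy : y ∈ annulus n I) (u v : EuclideanSpace ℝ (Fin n)) :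
    inducedMetric (rotationChart n f) y u v =
      Real.sinh (f (Real.log ‖y‖)) ^ 2 / ‖y‖ ^ 2 * inner ℝ u v
      + (1 + deriv f (Real.log ‖y‖) ^ 2 - Real.sinh (f (Real.log ‖y‖)) ^ 2) / ‖y‖ ^ 4
        * (inner ℝ y u * inner ℝ y v) := by
  have h1 : 1 - Real.tanh (f (Real.log ‖y‖) / 2) ^ 2 ≠ 0 := by
    linarith [h.isProfile.sq_lt_one hy.2]
  rw [rotationChart_eq, h.isProfile.inducedMetric_revolutionChart hy,
    conformal_factor_mul_tanh_half_sq, mul_sub, conformal_factor_mul_tanh_half_sq]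
  congr 3
  field_simp
  ring

theorem coordMatrix_inducedMetric (h : IsSolution n a I f) {y : EuclideanSpace ℝ (Fin n)}
    (hy : y ∈ annulus n I) :
    coordMatrix (inducedMetric (rotationChart n f) y) =
      radialMatrix y (Real.sinh (f (Real.log ‖y‖)) ^ 2 / ‖y‖ ^ 2)
        ((1 + deriv f (Real.log ‖y‖) ^ 2 - Real.sinh (f (Real.log ‖y‖)) ^ 2) / ‖y‖ ^ 4) :=
  coordMatrix_eq_radialMatrix y (h.inducedMetric_rotationChart hy)

theorem sqrt_det_coordMatrix (hn : 2 ≤ n) (h : IsSolution n a I f)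
    {y : EuclideanSpace ℝ (Fin n)} (hy : y ∈ annulus n I) :
    √(coordMatrix (inducedMetric (rotationChart n f) y)).det =
      (‖y‖ ^ n)⁻¹ * (√(1 + deriv f (Real.log ‖y‖) ^ 2) *
        Real.sinh (f (Real.log ‖y‖)) ^ (n - 1)) := by
  have hr : 0 < ‖y‖ := norm_pos_iff.2 hy.1
  have hs := h.sinh_pos hy.2
  have hw : √(1 + deriv f (Real.log ‖y‖) ^ 2) ^ 2 = 1 + deriv f (Real.log ‖y‖) ^ 2 :=
    Real.sq_sqrt (by positivity)
  rw [h.coordMatrix_inducedMetric hy, det_radialMatrix y (by omega) (by positivity)]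
  obtain ⟨k, rfl⟩ : ∃ k, n = k + 1 := ⟨n - 1, by omega⟩
  rw [← Real.sqrt_sq (show 0 ≤ (‖y‖ ^ (k + 1))⁻¹ * (√(1 + deriv f (Real.log ‖y‖) ^ 2) *
    Real.sinh (f (Real.log ‖y‖)) ^ (k + 1 - 1)) by positivity)]
  congr 1
  rw [mul_pow, mul_pow, hw, Nat.add_sub_cancel, div_pow]
  field_simp
  ring

/-- The norm of the second fundamental form of the catenoid. -/
theorem secondFormNorm_rotationChart (hn : 2 ≤ n) (h : IsSolution n a I f)
    {N : EuclideanSpace ℝ (Fin n) → EuclideanSpace ℝ (Fin n) × ℝ}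
    (hN : IsUnitNormal (rotationChart n f) (annulus n I) N)
    {y : EuclideanSpace ℝ (Fin n)} (hy : y ∈ annulus n I) :
    secondFormNorm (rotationChart n f) N y =
      √(n * (n - 1)) * (Real.cosh (f (Real.log ‖y‖)) / Real.sinh (f (Real.log ‖y‖))) /
        √(1 + deriv f (Real.log ‖y‖) ^ 2) := by
  have hr : 0 < ‖y‖ := norm_pos_iff.2 hy.1
  have hs := h.sinh_pos hy.2
  have hp := h.isProfile
  have h1 : 0 < 1 - Real.tanh (f (Real.log ‖y‖) / 2) ^ 2 := by
    linarith [hp.sq_lt_one hy.2]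
  have hb := hp.pos _ hy.2
  obtain ⟨c, hc⟩ := hp.exists_of_normal hy (hN y hy).2
  have hunit := (hN y hy).1
  have hA := coordMatrix_eq_radialMatrix (α := _) (β := _) y
    (fun u v => (hp.secondForm_revolutionChart hy hc u v).trans
      ((mul_add _ _ _).trans (congrArg₂ _ (mul_assoc _ _ _).symm (mul_assoc _ _ _).symm)))
  have hC := one_add_tanh_half_sq_div (f (Real.log ‖y‖))
  have hS := conformal_factor_mul_tanh_half_sq (f (Real.log ‖y‖))
  rw [← rotationChart_eq] at hA
  rw [ambientMetric, rotationChart_eq, IsProfile.norm_fst_revolutionChart_sq hy.1, hc] at hunit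
  simp only [real_inner_self_eq_norm_sq, norm_smul, mul_pow, Real.norm_eq_abs, sq_abs] at hunit
  have hγδ : Real.sinh (f (Real.log ‖y‖)) ^ 2 / ‖y‖ ^ 2 +
      (1 + deriv f (Real.log ‖y‖) ^ 2 - Real.sinh (f (Real.log ‖y‖)) ^ 2) / ‖y‖ ^ 4 * ‖y‖ ^ 2 =
      (1 + deriv f (Real.log ‖y‖) ^ 2) / ‖y‖ ^ 2 := by
    field_simp
    ring
  rw [secondFormNorm, h.coordMatrix_inducedMetric hy, hA,
    trace_sq_inv_mul_radialMatrix y (by positivity) (by rw [hγδ]; positivity), hγδ]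
  simp only [mul_div_assoc, hC] at hunit ⊢
  set t := Real.log ‖y‖
  set p := deriv f t
  set S := Real.sinh (f t)
  set C := Real.cosh (f t)
  set b := Real.tanh (f t / 2)
  set r := ‖y‖
  have hw : 0 < 1 + p ^ 2 := by positivity
  generalize 1 - b ^ 2 = D at *
  -- Unit length determines `c` only up to sign, but `|A|²` involves only `c²`.
  have hc2 : (2 / D) ^ 2 * c ^ 2 * r ^ 2 * (1 + p ^ 2) = 1 := by
    refine Eq.trans ?_ hunit
    field_simp
  have hc2' : (2 / D) ^ 2 * c ^ 2 * r ^ 2 = 1 / (1 + p ^ 2) := by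
    rw [eq_div_iff hw.ne', hc2]
  have hk1 : ((2 / D) ^ 2 * (c / r) * -(b * C) / (S ^ 2 / r ^ 2)) ^ 2 =
      C ^ 2 / (S ^ 2 * (1 + p ^ 2)) := by
    calc _ = ((2 / D) ^ 2 * c ^ 2 * r ^ 2) * ((2 / D) ^ 2 * b ^ 2) * C ^ 2 / S ^ 4 := by
          field_simp
      _ = _ := by
          rw [hc2', hS]
          field_simp
  -- The catenary equation, already substituted into the second derivative of the profile, makes the
  -- meridian curvature `n - 1` times the spherical one in absolute value; hence the factor `(n - 1)
  -- + (n - 1)² = n (n - 1)` in `|A|²`.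
  have hk2 : (((2 / D) ^ 2 * (c / r) * -(b * C) + (2 / D) ^ 2 * (c / r) *
      ((D / 2 * ((n - 1) * (C / S) * (1 + p ^ 2) - b * p ^ 2) + 2 / D * b * (D / 2 * p) ^ 2 + b * C)
        / r ^ 2) * r ^ 2) / ((1 + p ^ 2) / r ^ 2)) ^ 2 =
      (n - 1) ^ 2 * (C ^ 2 / (S ^ 2 * (1 + p ^ 2))) := by
    calc _ = ((2 / D) ^ 2 * c ^ 2 * r ^ 2) * ((n - 1) ^ 2 * C ^ 2 / S ^ 2) := by
          field_simp
          ring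
      _ = _ := by
          rw [hc2']
          field_simp
  have hn1 : (0 : ℝ) ≤ (n : ℝ) - 1 := by
    have : (2 : ℝ) ≤ n := by exact_mod_cast hn
    linarith
  have hC0 : 0 ≤ C := (Real.cosh_pos _).le
  have hnonneg : 0 ≤ √(n * (n - 1)) * (C / S / √(1 + p ^ 2)) := by positivity
  rw [← Real.sqrt_sq hnonneg]
  congr 1
  trans ((n : ℝ) - 1) * (C ^ 2 / (S ^ 2 * (1 + p ^ 2))) +
    (n - 1) ^ 2 * (C ^ 2 / (S ^ 2 * (1 + p ^ 2)))
  · rw [← hk2, ← hk1]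
    simp only [mul_div_assoc]
  · rw [mul_pow, div_pow, div_pow, Real.sq_sqrt (by positivity), Real.sq_sqrt hw.le]
    field_simp
    ring

end IsSolution

/-! ### Gauss curvature of a rotational conformal metric -/

theorem christoffel_congr {W : Type*} [NormedAddCommGroup W] [NormedSpace ℝ W]
    {g g' : W → W → W → ℝ} {p : W} (h : ∀ᶠ q in 𝓝 p, ∀ u v, g q u v = g' q u v) (u v w : W) :
    christoffel g p u v w = christoffel g' p u v w := by
  have h1 : ∀ v w : W, fderiv ℝ (fun q => g q v w) p = fderiv ℝ (fun q => g' q v w) p :=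
    fun v w => Filter.EventuallyEq.fderiv_eq (h.mono fun q hq => hq v w)
  simp only [christoffel, h1]

section Rotational

variable {n : ℕ} {I : Set ℝ} {S S₁ S₂ : ℝ → ℝ} {k : ℝ}

/-- The metric `S(t) ((1 + k) dt² + dξ²)` in the chart `y = eᵗ ξ`. -/
def rotationalMetric {n : ℕ} (S : ℝ → ℝ) (k : ℝ) (q u v : EuclideanSpace ℝ (Fin n)) : ℝ :=
  S (Real.log ‖q‖) / ‖q‖ ^ 2 * inner ℝ u v
    + k * S (Real.log ‖q‖) / ‖q‖ ^ 4 * (inner ℝ q u * inner ℝ q v)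

theorem hasFDerivAt_radial_div_pow {y : EuclideanSpace ℝ (Fin n)} (hy : y ≠ 0) {P : ℝ → ℝ} {p : ℝ}
    (hP : HasDerivAt P p (Real.log ‖y‖)) (m : ℕ) :
    HasFDerivAt (fun q : EuclideanSpace ℝ (Fin n) => P (Real.log ‖q‖) / ‖q‖ ^ m)
      (((p - m * P (Real.log ‖y‖)) / ‖y‖ ^ (m + 2)) • innerSL ℝ y) y := by
  have hr : 0 < ‖y‖ := norm_pos_iff.2 hy
  have h1 := hasFDerivAt_radial hy (hasDerivAt_mul_exp_neg hP m)
  rw [exp_neg_nat_mul_log hr] at h1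
  have h2 : ((p - m * P (Real.log ‖y‖)) * (‖y‖ ^ m)⁻¹) / ‖y‖ ^ 2 =
      (p - m * P (Real.log ‖y‖)) / ‖y‖ ^ (m + 2) := by
    rw [pow_add]
    field_simp
  rw [h2] at h1
  refine h1.congr_of_eventuallyEq ?_
  filter_upwards [isOpen_ne.mem_nhds hy] with q hq
  rw [exp_neg_nat_mul_log (norm_pos_iff.2 hq), div_eq_mul_inv]

theorem hasFDerivAt_inner_left (y v : EuclideanSpace ℝ (Fin n)) :
    HasFDerivAt (fun q : EuclideanSpace ℝ (Fin n) => (inner ℝ q v : ℝ)) (innerSL ℝ v) y := by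
  simp only [real_inner_comm v]
  exact (innerSL ℝ v).hasFDerivAt

theorem christoffel_rotationalMetric {y : EuclideanSpace ℝ (Fin n)} (hy : y ≠ 0) {s : ℝ}
    (hS : HasDerivAt S s (Real.log ‖y‖)) (u v w : EuclideanSpace ℝ (Fin n)) :
    christoffel (rotationalMetric S k) y u v w =
      (s - 2 * S (Real.log ‖y‖)) / ‖y‖ ^ 4 *
        ((inner ℝ y u * inner ℝ v w + inner ℝ y v * inner ℝ u w
          - inner ℝ u v * inner ℝ y w) / 2)
      + S (Real.log ‖y‖) / ‖y‖ ^ 4 * (k * (inner ℝ u v * inner ℝ y w))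
      + (s - 4 * S (Real.log ‖y‖)) / ‖y‖ ^ 6 *
        (k * (inner ℝ y u * inner ℝ y v * inner ℝ y w) / 2) := by
  have key : ∀ u v w : EuclideanSpace ℝ (Fin n),
      fderiv ℝ (fun q => rotationalMetric S k q v w) y u =
        (s - 2 * S (Real.log ‖y‖)) / ‖y‖ ^ 4 * inner ℝ y u * inner ℝ v w
        + (s - 4 * S (Real.log ‖y‖)) / ‖y‖ ^ 6 * inner ℝ y u * (k * (inner ℝ y v * inner ℝ y w))
        + S (Real.log ‖y‖) / ‖y‖ ^ 4 *
          (k * (inner ℝ u v * inner ℝ y w + inner ℝ y v * inner ℝ u w)) := by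
    intro u v w
    have h1 := ((hasFDerivAt_radial_div_pow hy hS 2).mul_const (inner ℝ v w)).fun_add
      ((hasFDerivAt_radial_div_pow hy hS 4).fun_mul
        (((hasFDerivAt_inner_left y v).fun_mul (hasFDerivAt_inner_left y w)).const_mul k))
    have h2 : (fun q => rotationalMetric S k q v w) = fun q : EuclideanSpace ℝ (Fin n) =>
        S (Real.log ‖q‖) / ‖q‖ ^ 2 * inner ℝ v w
        + S (Real.log ‖q‖) / ‖q‖ ^ 4 * (k * (inner ℝ q v * inner ℝ q w)) := by
      funext q
      rw [rotationalMetric]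
      ring
    rw [h2, h1.fderiv]
    simp only [_root_.add_apply, _root_.smul_apply, innerSL_apply_apply, smul_eq_mul,
      real_inner_comm u v, real_inner_comm u w]
    push_cast
    ring
  rw [christoffel, key, key, key, real_inner_comm v u, real_inner_comm w u, real_inner_comm w v]
  ring

theorem fderiv_christoffel_rotationalMetric (hI : IsOpen I)
    (hS : ∀ t ∈ I, HasDerivAt S (S₁ t) t) (hS₁ : ∀ t ∈ I, HasDerivAt S₁ (S₂ t) t)
    {y : EuclideanSpace ℝ (Fin n)} (hy : y ∈ annulus n I) (u v w z : EuclideanSpace ℝ (Fin n)) :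
    fderiv ℝ (fun q => christoffel (rotationalMetric S k) q v w z) y u =
      (S₂ (Real.log ‖y‖) - 6 * S₁ (Real.log ‖y‖) + 8 * S (Real.log ‖y‖)) / ‖y‖ ^ 6 * inner ℝ y u *
        ((inner ℝ y v * inner ℝ w z + inner ℝ y w * inner ℝ v z
          - inner ℝ v w * inner ℝ y z) / 2)
      + (S₁ (Real.log ‖y‖) - 2 * S (Real.log ‖y‖)) / ‖y‖ ^ 4 *
        ((inner ℝ u v * inner ℝ w z + inner ℝ u w * inner ℝ v z
          - inner ℝ v w * inner ℝ u z) / 2)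
      + (S₁ (Real.log ‖y‖) - 4 * S (Real.log ‖y‖)) / ‖y‖ ^ 6 * inner ℝ y u *
        (k * (inner ℝ v w * inner ℝ y z))
      + S (Real.log ‖y‖) / ‖y‖ ^ 4 * (k * (inner ℝ v w * inner ℝ u z))
      + (S₂ (Real.log ‖y‖) - 10 * S₁ (Real.log ‖y‖) + 24 * S (Real.log ‖y‖)) / ‖y‖ ^ 8
        * inner ℝ y u * (k * (inner ℝ y v * inner ℝ y w * inner ℝ y z) / 2)
      + (S₁ (Real.log ‖y‖) - 4 * S (Real.log ‖y‖)) / ‖y‖ ^ 6 *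
        (k * (inner ℝ u v * inner ℝ y w * inner ℝ y z + inner ℝ y v * inner ℝ u w * inner ℝ y z
          + inner ℝ y v * inner ℝ y w * inner ℝ u z) / 2) := by
  have hy0 := hy.1
  have hSy := hS _ hy.2
  have hS1y := hS₁ _ hy.2
  have hi := hasFDerivAt_inner_left y
  have d1 : HasDerivAt (fun t => S₁ t - 2 * S t) _ _ := hS1y.fun_sub (hSy.const_mul 2)
  have d2 : HasDerivAt (fun t => S₁ t - 4 * S t) _ _ := hS1y.fun_sub (hSy.const_mul 4)
  have h1 := (((hasFDerivAt_radial_div_pow hy0 d1 4).fun_mul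
      ((((hi v).mul_const (inner ℝ w z)).fun_add ((hi w).mul_const (inner ℝ v z))).fun_sub
        ((hi z).const_mul (inner ℝ v w)) |>.mul_const (1 / 2))).fun_add
    ((hasFDerivAt_radial_div_pow hy0 hSy 4).fun_mul
      (((hi z).const_mul (inner ℝ v w)).const_mul k))).fun_add
    ((hasFDerivAt_radial_div_pow hy0 d2 6).fun_mul
      ((((hi v).fun_mul (hi w)).fun_mul (hi z)).const_mul (k / 2)))
  have h2 : (fun q => christoffel (rotationalMetric S k) q v w z) =ᶠ[𝓝 y] fun q =>
      (S₁ (Real.log ‖q‖) - 2 * S (Real.log ‖q‖)) / ‖q‖ ^ 4 *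
        ((inner ℝ q v * inner ℝ w z + inner ℝ q w * inner ℝ v z
          - inner ℝ v w * inner ℝ q z) * (1 / 2))
      + S (Real.log ‖q‖) / ‖q‖ ^ 4 * (k * (inner ℝ v w * inner ℝ q z))
      + (S₁ (Real.log ‖q‖) - 4 * S (Real.log ‖q‖)) / ‖q‖ ^ 6 *
        (k / 2 * (inner ℝ q v * inner ℝ q w * inner ℝ q z)) := by
    filter_upwards [(isOpen_annulus n hI).mem_nhds hy] with q hq
    rw [christoffel_rotationalMetric hq.1 (hS _ hq.2)]
    ring
  rw [h2.fderiv_eq, h1.fderiv]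
  simp only [_root_.add_apply, _root_.sub_apply, _root_.smul_apply, innerSL_apply_apply,
    smul_eq_mul, real_inner_comm u v, real_inner_comm u w, real_inner_comm u z]
  push_cast
  ring

theorem coordMatrix_rotationalMetric (y : EuclideanSpace ℝ (Fin n)) :
    coordMatrix (rotationalMetric S k y) =
      radialMatrix y (S (Real.log ‖y‖) / ‖y‖ ^ 2) (k * S (Real.log ‖y‖) / ‖y‖ ^ 4) :=
  coordMatrix_eq_radialMatrix y fun _ _ => rfl

/-- The metric is `S` times the flat metric `(1 + k) dt² + dξ²`, so its curvature is `-(log S)'' /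
(2 (1 + k) S)`. -/
theorem gaussCurvature_rotationalMetric (hI : IsOpen I) (hpos : ∀ t ∈ I, 0 < S t)
    (hk : 0 < 1 + k)
    (hS : ∀ t ∈ I, HasDerivAt S (S₁ t) t) (hS₁ : ∀ t ∈ I, HasDerivAt S₁ (S₂ t) t)
    {y : EuclideanSpace ℝ (Fin 2)} (hy : y ∈ annulus 2 I) :
    gaussCurvature (rotationalMetric S k) y =
      -(S (Real.log ‖y‖) * S₂ (Real.log ‖y‖) - S₁ (Real.log ‖y‖) ^ 2) /
        (2 * (1 + k) * S (Real.log ‖y‖) ^ 3) := by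
  have hr : 0 < ‖y‖ := norm_pos_iff.2 hy.1
  have hs := hpos _ hy.2
  have hr2 : ‖y‖ ^ 2 = y.ofLp 0 ^ 2 + y.ofLp 1 ^ 2 := by
    rw [EuclideanSpace.norm_sq_eq, Fin.sum_univ_two, Real.norm_eq_abs, Real.norm_eq_abs, sq_abs,
      sq_abs]
  have e1 : S (Real.log ‖y‖) / ‖y‖ ^ 2 + k * S (Real.log ‖y‖) / ‖y‖ ^ 4 * ‖y‖ ^ 2 =
      S (Real.log ‖y‖) * (1 + k) / ‖y‖ ^ 2 := by
    field_simp
  have hc : ∀ u v w : EuclideanSpace ℝ (Fin 2), christoffel (rotationalMetric S k) y u v w = _ :=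
    christoffel_rotationalMetric hy.1 (hS _ hy.2)
  rw [gaussCurvature, riemannTensor, fderiv_christoffel_rotationalMetric hI hS hS₁ hy,
    fderiv_christoffel_rotationalMetric hI hS hS₁ hy, covectorInner, covectorInner,
    coordMatrix_rotationalMetric, det_radialMatrix y one_le_two (by positivity),
    inv_radialMatrix y (by positivity) (by rw [e1]; positivity), e1]
  simp only [Fin.sum_univ_two, hc, inner_stdVec, inner_stdVec_right y, radialMatrix,
    Matrix.add_apply, Matrix.smul_apply, vecMulVec_apply, smul_eq_mul, Matrix.one_apply]
  simp only [Fin.isValue, reduceIte, zero_ne_one, one_ne_zero, mul_zero, mul_one, zero_add,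
    add_zero, Nat.add_one_sub_one, pow_one, zero_mul, sub_zero, zero_sub]
  -- Only even powers of the norm occur, so with `R = x₀² + x₁²` the claim is a rational identity.
  have p4 : ‖y‖ ^ 4 = (‖y‖ ^ 2) ^ 2 := by ring
  have p6 : ‖y‖ ^ 6 = (‖y‖ ^ 2) ^ 3 := by ring
  have p8 : ‖y‖ ^ 8 = (‖y‖ ^ 2) ^ 4 := by ring
  rw [p4, p6, p8]
  have hR : 0 < ‖y‖ ^ 2 := by positivity
  generalize ‖y‖ ^ 2 = R at *
  generalize S (Real.log ‖y‖) = s at *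
  generalize S₁ (Real.log ‖y‖) = s₁ at *
  generalize S₂ (Real.log ‖y‖) = s₂ at *
  generalize y.ofLp 0 = x₀ at *
  generalize y.ofLp 1 = x₁ at *
  field_simp
  subst hr2
  ring

end Rotational

theorem gaussCurvature_congr
    {g g' : EuclideanSpace ℝ (Fin 2) → EuclideanSpace ℝ (Fin 2) → EuclideanSpace ℝ (Fin 2) → ℝ}
    {y : EuclideanSpace ℝ (Fin 2)} (h : ∀ᶠ q in 𝓝 y, ∀ u v, g q u v = g' q u v) :
    gaussCurvature g y = gaussCurvature g' y := by
  have h1 : ∀ᶠ q in 𝓝 y, ∀ u v w, christoffel g q u v w = christoffel g' q u v w :=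
    h.eventually_nhds.mono fun q hq => christoffel_congr hq
  have h2 : ∀ v w z, fderiv ℝ (fun q => christoffel g q v w z) y =
      fderiv ℝ (fun q => christoffel g' q v w z) y :=
    fun v w z => Filter.EventuallyEq.fderiv_eq (h1.mono fun q hq => hq v w z)
  have h3 : christoffel g y = christoffel g' y := by
    funext u v w
    exact h1.self_of_nhds u v w
  have h4 : coordMatrix (g y) = coordMatrix (g' y) := by
    have : g y = g' y := by
      funext u v
      exact h.self_of_nhds u v
    rw [this]
  simp only [gaussCurvature, riemannTensor, covectorInner, h2, h3, h4]

/-! ### Reduction to integrals over `I` and the final estimates -/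

/-- Nothing is known about `f` outside `I`, so densities are cut off before being integrated. -/
theorem measurable_indicator_of_continuousOn {I : Set ℝ} (hI : IsOpen I) {F : ℝ → ℝ≥0∞}
    (hF : ContinuousOn F I) : Measurable (I.indicator F) := by
  classical
  rw [← piecewise_eq_indicator]
  exact hF.measurable_piecewise continuousOn_const hI.measurableSet

namespace IsSolution

variable {n : ℕ} {a : ℝ} {I : Set ℝ} {f : ℝ → ℝ}

theorem continuousOn_volumeDensity (h : IsSolution n a I f) :
    ContinuousOn (fun t => √(1 + deriv f t ^ 2) * Real.sinh (f t) ^ (n - 1)) I := by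
  have h1 := h.continuousOn_deriv
  have h2 := h.continuousOn
  exact (Real.continuous_sqrt.comp_continuousOn (continuousOn_const.add (h1.pow 2))).mul
    ((Real.continuous_sinh.comp_continuousOn h2).pow _)

theorem lintegral_rotationMeasure (hn : 2 ≤ n) (h : IsSolution n a I f) {Φ : ℝ → ℝ≥0∞}
    (hΦ : Measurable Φ) :
    ∫⁻ y in annulus n I, Φ (Real.log ‖y‖) ∂(rotationMeasure n I f) =
      (volume : Measure (EuclideanSpace ℝ (Fin n))).toSphere univ *
        ∫⁻ t in I, ENNReal.ofReal (√(1 + deriv f t ^ 2) * Real.sinh (f t) ^ (n - 1)) * Φ t := by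
  have hA := measurableSet_annulus n h.isOpen.measurableSet
  set D : ℝ → ℝ≥0∞ := I.indicator fun t =>
    ENNReal.ofReal (√(1 + deriv f t ^ 2) * Real.sinh (f t) ^ (n - 1)) with hD
  have hDm : Measurable D := measurable_indicator_of_continuousOn h.isOpen
    (ENNReal.continuous_ofReal.comp_continuousOn h.continuousOn_volumeDensity)
  have hlog : Measurable fun y : EuclideanSpace ℝ (Fin n) => Real.log ‖y‖ :=
    Real.measurable_log.comp measurable_norm
  have hm : rotationMeasure n I f = (volume.restrict (annulus n I)).withDensity
      fun y => ENNReal.ofReal ((‖y‖ ^ n)⁻¹) * D (Real.log ‖y‖) := by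
    refine withDensity_congr_ae ?_
    filter_upwards [ae_restrict_mem hA] with y hy
    rw [h.sqrt_det_coordMatrix hn hy, ENNReal.ofReal_mul (by positivity), hD,
      indicator_of_mem hy.2]
  have hdm : Measurable fun y : EuclideanSpace ℝ (Fin n) =>
      ENNReal.ofReal ((‖y‖ ^ n)⁻¹) * D (Real.log ‖y‖) :=
    Measurable.mul (by fun_prop) (hDm.comp hlog)
  have hres : (rotationMeasure n I f).restrict (annulus n I) = rotationMeasure n I f := by
    rw [hm, restrict_withDensity hA, Measure.restrict_restrict hA, inter_self]
  rw [hres, hm, lintegral_withDensity_eq_lintegral_mul (g := fun y => Φ (Real.log ‖y‖)) _ hdm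
    (hΦ.comp hlog)]
  have h1 := lintegral_annulus hn h.isOpen.measurableSet (hDm.mul hΦ)
  simp only [Pi.mul_apply, ← mul_assoc] at h1 ⊢
  refine h1.trans ?_
  congr 1
  refine setLIntegral_congr_fun h.isOpen.measurableSet fun t ht => ?_
  simp only [hD, indicator_of_mem ht]

theorem coth_le (hn : 2 ≤ n) (h : IsSolution n a I f) {t : ℝ} (ht : t ∈ I) :
    Real.cosh (f t) / Real.sinh (f t) ≤ Real.cosh a / Real.sinh a := by
  rw [div_le_div_iff₀ (h.sinh_pos ht) h.sinh_initial_pos]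
  have h1 : 0 ≤ Real.sinh (f t - a) :=
    Real.sinh_nonneg_iff.2 (sub_nonneg.2 (h.initial_le hn ht))
  rw [Real.sinh_sub] at h1
  linarith

/-- By the first integral `sinh^(n-1) f = w sinh^(n-1) a`, so the density contributes `w²` against
`w^(-n)` from `|A|ⁿ`; here `w ≥ 1` and `n ≥ 2`, and `coth f ≤ coth a`. -/
theorem curvature_density_le (hn : 2 ≤ n) (h : IsSolution n a I f) {t : ℝ} (ht : t ∈ I) :
    √(1 + deriv f t ^ 2) * Real.sinh (f t) ^ (n - 1) *
      (√(n * (n - 1)) * (Real.cosh (f t) / Real.sinh (f t)) / √(1 + deriv f t ^ 2)) ^ n ≤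
    (√(n * (n - 1)) * (Real.cosh a / Real.sinh a)) ^ n * Real.sinh a ^ (n - 1) := by
  have hs := h.sinh_pos ht
  have hsa := h.sinh_initial_pos
  have hc : 0 ≤ Real.cosh (f t) / Real.sinh (f t) := zero_le_one.trans (h.one_le_coth ht)
  have hw1 : 1 ≤ √(1 + deriv f t ^ 2) := Real.one_le_sqrt.2 (by nlinarith [sq_nonneg (deriv f t)])
  have hw : Real.sinh (f t) ^ (n - 1) = √(1 + deriv f t ^ 2) * Real.sinh a ^ (n - 1) := by
    rw [h.sqrt_one_add_deriv_sq hn ht, div_pow]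
    field_simp
  rw [hw]
  generalize √(1 + deriv f t ^ 2) = w at *
  have hw0 : 0 < w := by linarith
  calc w * (w * Real.sinh a ^ (n - 1)) *
        (√(n * (n - 1)) * (Real.cosh (f t) / Real.sinh (f t)) / w) ^ n
      = (√(n * (n - 1)) * (Real.cosh (f t) / Real.sinh (f t))) ^ n * Real.sinh a ^ (n - 1)
          * (w ^ 2 / w ^ n) := by
        rw [div_pow]
        ring
    _ ≤ (√(n * (n - 1)) * (Real.cosh (f t) / Real.sinh (f t))) ^ n * Real.sinh a ^ (n - 1) * 1 := by
        gcongr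
        rw [div_le_one (by positivity)]
        exact pow_le_pow_right₀ hw1 hn
    _ ≤ _ := by
        rw [mul_one]
        exact mul_le_mul_of_nonneg_right (pow_le_pow_left₀ (by positivity)
          (mul_le_mul_of_nonneg_left (h.coth_le hn ht) (by positivity)) n) (by positivity)

/-- The catenoid has finite total extrinsic curvature. -/
theorem lintegral_secondFormNorm_pow_lt_top (hn : 2 ≤ n) (h : IsSolution n a I f)
    {N : EuclideanSpace ℝ (Fin n) → EuclideanSpace ℝ (Fin n) × ℝ}
    (hN : IsUnitNormal (rotationChart n f) (annulus n I) N) :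
    ∫⁻ y in annulus n I, ENNReal.ofReal (secondFormNorm (rotationChart n f) N y ^ n)
      ∂(rotationMeasure n I f) < ∞ := by
  have hA := measurableSet_annulus n h.isOpen.measurableSet
  set F : ℝ → ℝ := fun t =>
    (√(n * (n - 1)) * (Real.cosh (f t) / Real.sinh (f t)) / √(1 + deriv f t ^ 2)) ^ n with hF
  have hFc : ContinuousOn F I := by
    have h1 := h.continuousOn_deriv
    have h2 := h.continuousOn
    refine ((continuousOn_const.mul ((Real.continuous_cosh.comp_continuousOn h2).div
      (Real.continuous_sinh.comp_continuousOn h2) fun t ht => (h.sinh_pos ht).ne')).div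
      (Real.continuous_sqrt.comp_continuousOn (continuousOn_const.add (h1.pow 2)))
      fun t _ => ?_).pow n
    have : 0 < √(1 + deriv f t ^ 2) := by positivity
    exact this.ne'
  have hm : Measurable (I.indicator fun t => ENNReal.ofReal (F t)) :=
    measurable_indicator_of_continuousOn h.isOpen
      (ENNReal.continuous_ofReal.comp_continuousOn hFc)
  have h1 : ∫⁻ y in annulus n I, ENNReal.ofReal (secondFormNorm (rotationChart n f) N y ^ n)
      ∂(rotationMeasure n I f) =
      ∫⁻ y in annulus n I, (I.indicator fun t => ENNReal.ofReal (F t)) (Real.log ‖y‖)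
        ∂(rotationMeasure n I f) := by
    refine setLIntegral_congr_fun hA fun y hy => ?_
    simp only [indicator_of_mem hy.2, h.secondFormNorm_rotationChart hn hN hy, hF]
  rw [h1, h.lintegral_rotationMeasure hn hm]
  refine ENNReal.mul_lt_top (measure_lt_top _ _) ?_
  have h2 : ∀ t ∈ I, ENNReal.ofReal (√(1 + deriv f t ^ 2) * Real.sinh (f t) ^ (n - 1)) *
      (I.indicator fun t => ENNReal.ofReal (F t)) t ≤
      ENNReal.ofReal ((√(n * (n - 1)) * (Real.cosh a / Real.sinh a)) ^ n
        * Real.sinh a ^ (n - 1)) := by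
    intro t ht
    have := h.sinh_pos ht
    rw [indicator_of_mem ht, ← ENNReal.ofReal_mul (by positivity)]
    exact ENNReal.ofReal_le_ofReal (h.curvature_density_le hn ht)
  refine (setLIntegral_mono' h.isOpen.measurableSet h2).trans_lt ?_
  rw [setLIntegral_const]
  refine ENNReal.mul_lt_top ENNReal.ofReal_lt_top ?_
  -- A bounded integrand suffices because `I` has length at most `π`.
  exact (measure_mono (h.subset_Icc hn)).trans_lt (by simp)

/-- For `n = 2` the first integral reads `1 + f'² = sinh² f / sinh² a`, so the metric is `sinh² f
(dt² / sinh² a + dξ²)` and `1 + k = 1 / sinh² a`. -/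
theorem inducedMetric_eq_rotationalMetric {f : ℝ → ℝ} (h : IsSolution 2 a I f)
    {y : EuclideanSpace ℝ (Fin 2)} (hy : y ∈ annulus 2 I) (u v : EuclideanSpace ℝ (Fin 2)) :
    inducedMetric (rotationChart 2 f) y u v =
      rotationalMetric (fun t => Real.sinh (f t) ^ 2) (1 / Real.sinh a ^ 2 - 1) y u v := by
  rw [h.inducedMetric_rotationChart hy, rotationalMetric, h.one_add_deriv_sq le_rfl hy.2]
  congr 3
  have := h.sinh_initial_pos
  simp only [Nat.add_one_sub_one, pow_one]
  field_simp

/-- The Gauss curvature of the two-dimensional catenoid. -/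
theorem gaussCurvature_rotationChart (h : IsSolution 2 a I f) {y : EuclideanSpace ℝ (Fin 2)}
    (hy : y ∈ annulus 2 I) :
    gaussCurvature (inducedMetric (rotationChart 2 f)) y =
      -((Real.cosh (f (Real.log ‖y‖)) / Real.sinh (f (Real.log ‖y‖))) ^ 2
        + deriv f (Real.log ‖y‖) ^ 2) / (1 + deriv f (Real.log ‖y‖) ^ 2) := by
  have hsa := h.sinh_initial_pos
  rw [gaussCurvature_congr (((isOpen_annulus 2 h.isOpen).mem_nhds hy |> Filter.mem_of_superset
    <| fun q hq => h.inducedMetric_eq_rotationalMetric hq) : ∀ᶠ q in 𝓝 y, _)]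
  have hS : ∀ t ∈ I, HasDerivAt (fun t => Real.sinh (f t) ^ 2)
      (2 * (Real.sinh (f t) * Real.cosh (f t) * deriv f t)) t := fun t ht =>
    ((h.hasDerivAt ht).sinh.fun_pow 2).congr_deriv (by push_cast; ring)
  have hS₁ : ∀ t ∈ I, HasDerivAt (fun t => 2 * (Real.sinh (f t) * Real.cosh (f t) * deriv f t))
      (2 * ((Real.cosh (f t) ^ 2 + Real.sinh (f t) ^ 2) * deriv f t ^ 2 +
        Real.cosh (f t) ^ 2 * (1 + deriv f t ^ 2))) t := by
    intro t ht
    have hs := (h.sinh_pos ht).ne'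
    refine ((((h.hasDerivAt ht).sinh.fun_mul (h.hasDerivAt ht).cosh).fun_mul
      (h.ode t ht)).const_mul 2).congr_deriv ?_
    push_cast
    field_simp
    ring
  rw [gaussCurvature_rotationalMetric h.isOpen (fun t ht => by have := h.sinh_pos ht; positivity)
    (by rw [add_sub_cancel]; positivity) hS hS₁ hy]
  have hs := h.sinh_pos hy.2
  have hint := h.one_add_deriv_sq le_rfl hy.2
  have hcs := Real.cosh_sq (f (Real.log ‖y‖))
  simp only [Nat.add_one_sub_one, pow_one] at hint
  have hk : (1 + (1 / Real.sinh a ^ 2 - 1)) * (Real.sinh (f (Real.log ‖y‖)) ^ 2) ^ 3 =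
      (1 + deriv f (Real.log ‖y‖) ^ 2) * Real.sinh (f (Real.log ‖y‖)) ^ 4 := by
    rw [hint]
    field_simp
    ring
  rw [mul_assoc 2 (1 + _), hk]
  generalize Real.log ‖y‖ = t at *
  generalize deriv f t = p at *
  generalize Real.cosh (f t) = C at *
  generalize Real.sinh (f t) = s at *
  field_simp
  rw [hcs]
  ring

theorem one_le_abs_gaussCurvature (h : IsSolution 2 a I f) {y : EuclideanSpace ℝ (Fin 2)}
    (hy : y ∈ annulus 2 I) :
    1 ≤ |gaussCurvature (inducedMetric (rotationChart 2 f)) y| := by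
  rw [h.gaussCurvature_rotationChart hy, neg_div, abs_neg, abs_of_nonneg (by positivity),
    one_le_div (by positivity)]
  nlinarith [h.one_le_coth hy.2]

end IsSolution

/-- The catenoid has infinite volume. -/
theorem IsMaximalSolution.rotationMeasure_annulus {n : ℕ} {a : ℝ} {I : Set ℝ} {f : ℝ → ℝ}
    (hn : 2 ≤ n) (h : IsMaximalSolution n a I f) : rotationMeasure n I f (annulus n I) = ∞ := by
  have hs := h.toIsSolution
  have hsa := hs.sinh_initial_pos
  rw [← setLIntegral_one, hs.lintegral_rotationMeasure hn (Φ := fun _ => 1) measurable_const]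
  refine ENNReal.mul_eq_top.2 (Or.inl ⟨toSphere_univ_ne_zero hn, ?_⟩)
  -- Compare the volume density with a multiple of `|f'|`, whose integral is infinite because `f` is
  -- unbounded.
  have h1 : ∀ t ∈ I, ENNReal.ofReal (Real.sinh a ^ (n - 1)) * ENNReal.ofReal |deriv f t| ≤
      ENNReal.ofReal (√(1 + deriv f t ^ 2) * Real.sinh (f t) ^ (n - 1)) * 1 := by
    intro t ht
    rw [mul_one, ← ENNReal.ofReal_mul (by positivity), mul_comm]
    refine ENNReal.ofReal_le_ofReal ?_
    gcongr
    · exact Real.abs_le_sqrt (by linarith)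
    · exact Real.sinh_le_sinh.2 (hs.initial_le hn ht)
  have h2 := setLIntegral_mono' (μ := volume) hs.isOpen.measurableSet h1
  rw [lintegral_const_mul' _ _ ENNReal.ofReal_ne_top, lintegral_abs_deriv_eq_top hs.ordConnected
    ⟨0, hs.zero_mem⟩ (fun t ht => hs.hasDerivAt ht) hs.continuousOn_deriv (h.not_bddAbove hn),
    ENNReal.mul_top (by simpa using pow_pos hsa _)] at h2
  exact top_le_iff.1 h2

end Catenoid

end

/-- For `a > 0`, let `(I, f)` be the maximal solution of the Cauchy problem defining the catenary.
The `n`-dimensional catenoid in `ℍⁿ × ℝ` it generates has infinite volume and finite total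
extrinsic curvature `∫ |A|ⁿ`, and for `n = 2` infinite total intrinsic curvature `∫ |K|`. -/
theorem proposition3p3 (a : ℝ) (ha : 0 < a) :
    (∀ (n : ℕ), 2 ≤ n → ∀ (I : Set ℝ) (f : ℝ → ℝ), Catenoid.IsMaximalSolution n a I f →
      Catenoid.rotationMeasure n I f (Catenoid.annulus n I) = ∞ ∧
      ∀ N : EuclideanSpace ℝ (Fin n) → EuclideanSpace ℝ (Fin n) × ℝ,
        Catenoid.IsUnitNormal (Catenoid.rotationChart n f) (Catenoid.annulus n I) N →
        ∫⁻ y in Catenoid.annulus n I,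
          ENNReal.ofReal (Catenoid.secondFormNorm (Catenoid.rotationChart n f) N y ^ n)
            ∂(Catenoid.rotationMeasure n I f) < ∞) ∧
    (∀ (I : Set ℝ) (f : ℝ → ℝ), Catenoid.IsMaximalSolution 2 a I f →
      ∫⁻ y in Catenoid.annulus 2 I,
        ENNReal.ofReal
          |Catenoid.gaussCurvature (Catenoid.inducedMetric (Catenoid.rotationChart 2 f)) y|
          ∂(Catenoid.rotationMeasure 2 I f) = ∞) := by
  refine ⟨fun n hn I f h => ⟨h.rotationMeasure_annulus hn, fun N hN =>
    h.toIsSolution.lintegral_secondFormNorm_pow_lt_top hn hN⟩, fun I f h => ?_⟩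
  have hA := Catenoid.measurableSet_annulus 2 h.isOpen.measurableSet
  -- Write `∞` as the area, the integral of 1, and use `|K| ≥ 1` pointwise.
  rw [← top_le_iff, ← h.rotationMeasure_annulus le_rfl, ← MeasureTheory.setLIntegral_one]
  refine MeasureTheory.setLIntegral_mono' hA fun y hy => ?_
  rw [← ENNReal.ofReal_one]
  exact ENNReal.ofReal_le_ofReal (h.toIsSolution.one_le_abs_gaussCurvature hy)
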